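/- **Setting.** Let $G=\mathrm{SL}(2,\mathbb R)$, $k_\theta=\begin{pmatrix}\cos\theta&\sin\theta\\-\sin\theta&\cos\theta\end{pmatrix}$, $b_u=\begin{pmatrix}\cosh u&\sinh u\\ \sinh u&\cosh u\end{pmatrix}$, and $K=\{k_\theta\}=\mathrm{SO}(2)$ with the measure $dk=d\theta$ on $[0,2\pi)$. Let $\varepsilon,\xi\in\mathbb Z/2\mathbb Z$, write $|x|^s_\delta=\operatorname{sgn}(x)^\delta|x|^s$, and for $\mu\in\mathbb C$ put $$K^\xi_\mu(g)=|g_{11}|^{\frac{\mu-1}{2}}_{\xi+\varepsilon}\,|g_{21}|^{\frac{\mu-1}{2}}_{\xi},\qquad P^\xi_\mu f(g)=\int_K K^\xi_\mu(g^{-1}k)f(k)\,dk .$$ For $m\in\mathbb Z$ with $m\equiv\varepsilon \pmod 2$, let $\zeta_m$ be the function on $G$ with $\zeta_m(k_\theta)=e^{im\theta}$ and $\zeta_m\!\left(g\begin{pmatrix}t&x\\0&t^{-1}\end{pmatrix}\right)=|t|_\varepsilon^{-\mu-1}\zeta_m(g)$ for $t\in\mathbb R^\times$, $x\in\mathbb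 R$. For $\operatorname{Re}\mu>-1$ the integral defining $P^\xi_\mu\zeta_m(k_\theta b_u)$ converges absolutely; for general $\mu$, $\frac{1}{\Gamma((\mu+1)/2)}P^\xi_\mu\zeta_m(k_\theta b_u)$ denotes the value at $\nu=\mu$ of the entire continuation of $\nu\mapsto\frac{1}{\Gamma((\nu+1)/2)}\int_K K^\xi_\nu((k_\theta b_u)^{-1}k)\,\zeta_m(k)\,dk$ from $\operatorname{Re}\nu>-1$ (the integral is understood in the distributional sense). Let $_2F_1(a,b;c;x)$, $x<1$, be the Gauss hypergeometric function, i.e. the real-analytic continuation to $(-\infty,1)$ of the hypergeometric series, and for $u\in\mathbb R$ put $$\phi^{\alpha,\beta}_\nu(u)={}_2F_1\!\left(\tfrac{\alpha+\beta+1+i\nu}{2},\tfrac{\alpha+\beta+1-i\nu}{2};\alpha+1;-\sinh^2u\right),$$ $$\varphi^m_\mu(u)=\phi^{-\frac12,\frac m2}_{-\frac{i\mu}{2}}(u),\qquad \psi^m_\mu(u)=i\sinh(u)\,\phi^{\frac12,\frac m2}_{-\frac{i\mu}{2}}(u).$$ Finally let $\omega^\xi_m=(-1)^\xi+(-1)^m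 i^m$ and $$c_m(\mu)=\frac{2^{1-\mu}\,\pi\, e^{i\frac{m\pi}{4}}}{\Gamma\!\left(\frac{\mu+3+|m|}{4}\right)\Gamma\!\left(\frac{\mu+3-|m|}{4}\right)},$$ where $1/\Gamma$ is the entire function (zero at the poles of $\Gamma$). **Proposition.** For all $\varepsilon,\xi\in\mathbb Z/2\mathbb Z$, all $m\in\mathbb Z$ with $m\equiv\varepsilon\pmod 2$, all $\mu\in\mathbb C$ and all $\theta,u\in\mathbb R$, the entire continuation above exists and $$\frac{1}{\Gamma\!\left(\frac{\mu+1}{2}\right)}P^\xi_\mu\zeta_m(k_\theta b_u)=\zeta_m(k_\theta)\cosh^{\frac m2}(2u)\left(\omega^\xi_m\,c_m(\mu)\,\varphi^m_\mu(2u)+\frac i2\,\omega^{\xi+1}_m\,c_m(\mu-2)\,\psi^m_\mu(2u)\right).$$ -/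

import Mathlib

noncomputable section

namespace PoissonSL2

/-- The group `G = SL(2, ℝ)`. -/
abbrev G : Type := Matrix.SpecialLinearGroup (Fin 2) ℝ

/-- The rotation `k_θ`; these matrices form the maximal compact subgroup `K = SO(2)`. -/
def kRot (θ : ℝ) : G :=
  ⟨!![Real.cos θ, Real.sin θ; -Real.sin θ, Real.cos θ], by
    rw [Matrix.det_fin_two_of]; nlinarith [Real.sin_sq_add_cos_sq θ]⟩

/-- The hyperbolic element `b_u`. -/
def bHyp (u : ℝ) : G :=
  ⟨!![Real.cosh u, Real.sinh u; Real.sinh u, Real.cosh u], by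
    rw [Matrix.det_fin_two_of]; nlinarith [Real.cosh_sq u]⟩

/-- The upper triangular element with diagonal `(t, t⁻¹)` and upper right entry `x`; for `t ≠ 0`
these form the parabolic subgroup `P = MAN`. -/
def pUpper (t : ℝ) (ht : t ≠ 0) (x : ℝ) : G :=
  ⟨!![t, x; 0, t⁻¹], by rw [Matrix.det_fin_two_of]; simp [ht]⟩

/-- `|x|^s_δ = sgn(x)^δ |x|^s` for `δ ∈ ℤ/2ℤ` and complex `s`. -/
def signedPow (δ : ZMod 2) (s : ℂ) (x : ℝ) : ℂ :=
  ((SignType.sign x : ℝ) : ℂ) ^ δ.val * ((|x| : ℝ) : ℂ) ^ s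

/-- The kernel `K_{λ,μ}^ξ(g) = |g₁₁|^{(λ+μ-1)/2}_{ξ+ε} |g₂₁|^{(μ-λ-1)/2}_ξ`. -/
def kernel (ε ξ : ZMod 2) (lam μ : ℂ) (g : G) : ℂ :=
  signedPow (ξ + ε) ((lam + μ - 1) / 2) (g 0 0) * signedPow ξ ((μ - lam - 1) / 2) (g 1 0)

/-- The integrand `K_{λ,μ}^ξ(g⁻¹ k) f(k)` at `k = k_φ`. -/
def poissonIntegrand (ε ξ : ZMod 2) (lam μ : ℂ) (f : G → ℂ) (g : G) (φ : ℝ) : ℂ :=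
  kernel ε ξ lam μ (g⁻¹ * kRot φ) * f (kRot φ)

/-- The integral `P_{λ,μ}^ξ f(g) = ∫_K K_{λ,μ}^ξ(g⁻¹ k) f(k) dk`, where `dk = dφ` on `[0, 2π]`
(total mass `2π`). It converges for `Re μ > -1` and `λ` imaginary. -/
def poissonIntegral (ε ξ : ZMod 2) (lam μ : ℂ) (f : G → ℂ) (g : G) : ℂ :=
  ∫ φ in (0 : ℝ)..(2 * Real.pi), poissonIntegrand ε ξ lam μ f g φ

/-- `F` is the holomorphic continuation to all `ν ∈ ℂ` of the pairing of the distribution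
`k ↦ Γ((ν+1)/2)⁻¹ K_{λ,ν}^ξ(g⁻¹ k)` on `K` with `f|_K`: it is entire, and for `Re ν > -1` the
pairing is an absolutely convergent integral with value `F ν`. -/
def IsPoissonContinuation (ε ξ : ZMod 2) (lam : ℂ) (f : G → ℂ) (g : G) (F : ℂ → ℂ) : Prop :=
  Differentiable ℂ F ∧ ∀ ν : ℂ, -1 < ν.re →
    IntervalIntegrable (poissonIntegrand ε ξ lam ν f g) MeasureTheory.volume 0 (2 * Real.pi) ∧
    F ν = poissonIntegral ε ξ lam ν f g / Complex.Gamma ((ν + 1) / 2)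

open Classical in
/-- The normalized operator `(Γ((μ+1)/2)⁻¹ P_{λ,μ}^ξ) f(g)` for every `μ ∈ ℂ`, the integral over `K`
being understood in the distributional sense, that is, by holomorphic continuation in the parameter
of the kernel, with `f|_K` fixed (it is set to `0` if there is no continuation). -/
def normalizedPoisson (ε ξ : ZMod 2) (lam μ : ℂ) (f : G → ℂ) (g : G) : ℂ :=
  if h : ∃ F : ℂ → ℂ, IsPoissonContinuation ε ξ lam f g F then h.choose μ else 0

/-- The continuation is unique, so `normalizedPoisson` does not depend on any choice. -/
theorem normalizedPoisson_eq {ε ξ : ZMod 2} {lam : ℂ} {f : G → ℂ} {g : G} {F : ℂ → ℂ}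
    (hF : IsPoissonContinuation ε ξ lam f g F) (μ : ℂ) :
    normalizedPoisson ε ξ lam μ f g = F μ := by
  have h : ∃ F : ℂ → ℂ, IsPoissonContinuation ε ξ lam f g F := ⟨F, hF⟩
  have hc := h.choose_spec
  rw [normalizedPoisson, dif_pos h]
  have h1 : AnalyticOnNhd ℂ h.choose Set.univ := fun z _ => hc.1.analyticAt z
  have h2 : AnalyticOnNhd ℂ F Set.univ := fun z _ => hF.1.analyticAt z
  have hev : h.choose =ᶠ[nhds (0 : ℂ)] F := by
    have ho : IsOpen {ν : ℂ | -1 < ν.re} := isOpen_lt continuous_const Complex.continuous_re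
    filter_upwards [ho.mem_nhds (show (0 : ℂ) ∈ {ν : ℂ | -1 < ν.re} by simp)] with ν hν
    rw [(hc.2 ν hν).2, (hF.2 ν hν).2]
  exact congrFun (h1.eq_of_eventuallyEq h2 hev) μ

/-- The vector `ζ_m` of `Ind_P^G(ε ⊗ e^μ ⊗ 1)`, as a function on `G`: for
`g = k_θ diag(r, r⁻¹) n` with `r > 0` and `n ∈ N` one has `r = √(g₁₁² + g₂₁²)` and
`e^{iθ} = (g₁₁ - i g₂₁) / r`, and the value is `e^{imθ} r^{-μ-1}`. -/
def zeta (m : ℤ) (μ : ℂ) (g : G) : ℂ :=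
  (((g 0 0 : ℂ) - Complex.I * (g 1 0 : ℂ)) / ((Real.sqrt (g 0 0 ^ 2 + g 1 0 ^ 2) : ℝ) : ℂ)) ^ m *
    ((Real.sqrt (g 0 0 ^ 2 + g 1 0 ^ 2) : ℝ) : ℂ) ^ (-μ - 1)

/-- `ζ_m(k_θ) = e^{imθ}`. -/
theorem zeta_kRot (m : ℤ) (μ : ℂ) (θ : ℝ) :
    zeta m μ (kRot θ) = Complex.exp (Complex.I * m * θ) := by
  have h : Real.sqrt ((kRot θ) 0 0 ^ 2 + (kRot θ) 1 0 ^ 2) = 1 := by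
    simp [kRot]
  have h2 : ((kRot θ) 0 0 : ℂ) - Complex.I * ((kRot θ) 1 0 : ℂ)
      = Complex.exp (Complex.I * θ) := by
    rw [mul_comm Complex.I (θ : ℂ), Complex.exp_mul_I]
    simp [kRot]; ring
  rw [zeta, h, h2, Complex.ofReal_one, div_one, Complex.one_cpow, mul_one, ← Complex.exp_int_mul]
  congr 1; ring

/-- `ζ_m` satisfies `f(g man) = |t|_ε^{-μ-1} f(g)` when `m ≡ ε` modulo `2`. -/
theorem zeta_mul_pUpper (ε : ZMod 2) (m : ℤ) (hm : (m : ZMod 2) = ε) (μ : ℂ) (g : G)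
    (t : ℝ) (ht : t ≠ 0) (x : ℝ) :
    zeta m μ (g * pUpper t ht x) = signedPow ε (-μ - 1) t * zeta m μ g := by
  have e0 : (g * pUpper t ht x) 0 0 = t * g 0 0 := by
    change ((g : Matrix (Fin 2) (Fin 2) ℝ) * !![t, x; 0, t⁻¹]) 0 0 = _
    simp [Matrix.mul_apply, Fin.sum_univ_two, mul_comm]
  have e1 : (g * pUpper t ht x) 1 0 = t * g 1 0 := by
    change ((g : Matrix (Fin 2) (Fin 2) ℝ) * !![t, x; 0, t⁻¹]) 1 0 = _
    simp [Matrix.mul_apply, Fin.sum_univ_two, mul_comm]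
  have hr : Real.sqrt ((t * g 0 0) ^ 2 + (t * g 1 0) ^ 2)
      = |t| * Real.sqrt (g 0 0 ^ 2 + g 1 0 ^ 2) := by
    rw [← Real.sqrt_sq_eq_abs, ← Real.sqrt_mul (sq_nonneg t)]
    congr 1; ring
  have hs : ((t : ℂ) / ((|t| : ℝ) : ℂ)) ^ m = ((SignType.sign t : ℝ) : ℂ) ^ ε.val := by
    rcases lt_or_gt_of_ne ht with h | h
    · have ht' : (t : ℂ) ≠ 0 := by exact_mod_cast ht
      rw [abs_of_neg h, sign_neg h, Complex.ofReal_neg, div_neg, div_self ht']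
      subst hm
      have hv : ((m : ZMod 2).val : ℤ) = m % 2 := by
        rw [ZMod.val_intCast]; rfl
      have : ((-1 : ℂ)) ^ (m : ZMod 2).val = (-1 : ℂ) ^ (m % 2) := by
        rw [← hv, zpow_natCast]
      simp only [SignType.coe_neg_one, Complex.ofReal_neg, Complex.ofReal_one]
      rw [this]
      rcases Int.even_or_odd m with hm | hm
      · rw [hm.neg_one_zpow, Int.even_iff.mp hm, zpow_zero]
      · rw [hm.neg_one_zpow, Int.odd_iff.mp hm, zpow_one]
    · have ht' : (t : ℂ) ≠ 0 := by exact_mod_cast ht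
      rw [abs_of_pos h, sign_pos h, div_self ht']
      simp
  rw [zeta, zeta, signedPow, e0, e1, hr, Complex.ofReal_mul |t|,
    Complex.mul_cpow_ofReal_nonneg (abs_nonneg t) (Real.sqrt_nonneg _), ← hs]
  have hd : (((t * g 0 0 : ℝ) : ℂ) - Complex.I * ((t * g 1 0 : ℝ) : ℂ)) /
      (((|t| : ℝ) : ℂ) * ((Real.sqrt (g 0 0 ^ 2 + g 1 0 ^ 2) : ℝ) : ℂ))
      = ((t : ℂ) / ((|t| : ℝ) : ℂ)) *
        (((g 0 0 : ℂ) - Complex.I * (g 1 0 : ℂ)) /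
          ((Real.sqrt (g 0 0 ^ 2 + g 1 0 ^ 2) : ℝ) : ℂ)) := by
    rw [div_mul_div_comm]; congr 1; push_cast; ring
  rw [hd, mul_zpow]; ring

/-- `F` is the real-analytic continuation to `(-∞, 1)` of the sum of the hypergeometric series
`∑ (a)_n (b)_n / ((c)_n n!) x^n` on `(-1, 1)`. -/
def IsHypContinuation (a b c : ℂ) (F : ℝ → ℂ) : Prop :=
  AnalyticOnNhd ℝ F (Set.Iio 1) ∧
    ∀ x : ℝ, |x| < 1 → F x = ordinaryHypergeometric a b c (x : ℂ)

open Classical in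
/-- Gauss's hypergeometric function `₂F₁(a, b; c; x)` for real `x < 1` and `c ∉ {0, -1, -2, …}`,
by analytic continuation of the series along the real axis (it is set to `0` if there is no
continuation). -/
def hyp2F1 (a b c : ℂ) (x : ℝ) : ℂ :=
  if h : ∃ F : ℝ → ℂ, IsHypContinuation a b c F then h.choose x else 0

/-- The continuation is unique, so `hyp2F1` does not depend on any choice. -/
theorem hyp2F1_eq {a b c : ℂ} {F : ℝ → ℂ} (hF : IsHypContinuation a b c F) {x : ℝ} (hx : x < 1) :
    hyp2F1 a b c x = F x := by
  have h : ∃ F : ℝ → ℂ, IsHypContinuation a b c F := ⟨F, hF⟩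
  have hc := h.choose_spec
  rw [hyp2F1, dif_pos h]
  have hev : h.choose =ᶠ[nhds (0 : ℝ)] F := by
    filter_upwards [Metric.ball_mem_nhds (0 : ℝ) one_pos] with y hy
    have hy' : |y| < 1 := by simpa using hy
    rw [hc.2 y hy', hF.2 y hy']
  exact hc.1.eqOn_of_preconnected_of_eventuallyEq hF.1 isPreconnected_Iio
    (show (0 : ℝ) ∈ Set.Iio 1 by simp) hev hx

/-- The Jacobi function
`φ_ν^{α,β}(t) = ₂F₁((α+β+1+iν)/2, (α+β+1-iν)/2; α+1; -sinh² t)`. -/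
def jacobiFun (α β ν : ℂ) (t : ℝ) : ℂ :=
  hyp2F1 ((α + β + 1 + Complex.I * ν) / 2) ((α + β + 1 - Complex.I * ν) / 2) (α + 1)
    (-(Real.sinh t) ^ 2)

/-- `φ_μ^m(u)`, the Jacobi function with parameters `(-1/2, m/2)` at `-iμ/2`. -/
def phi (m : ℤ) (μ : ℂ) (u : ℝ) : ℂ :=
  jacobiFun (-1 / 2) ((m : ℂ) / 2) (-Complex.I * μ / 2) u

/-- `ψ_μ^m(u)`, which is `i sinh u` times the Jacobi function with parameters `(1/2, m/2)` at
`-iμ/2`. -/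
def psi (m : ℤ) (μ : ℂ) (u : ℝ) : ℂ :=
  Complex.I * (Real.sinh u : ℂ) * jacobiFun (1 / 2) ((m : ℂ) / 2) (-Complex.I * μ / 2) u

/-- `ω_m^ξ = (-1)^ξ + (-1)^m i^m`. -/
def omega (m : ℤ) (ξ : ZMod 2) : ℂ :=
  (-1) ^ ξ.val + (-1) ^ m * Complex.I ^ m

/-- `c_m(μ) = 2^{1-μ} π e^{imπ/4} / (Γ((μ+3+|m|)/4) Γ((μ+3-|m|)/4))`. At a pole of a Gamma factor
the value is `0`, as it is for the entire function `1/Γ`. -/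
def cCoeff (m : ℤ) (μ : ℂ) : ℂ :=
  (2 : ℂ) ^ (1 - μ) * Real.pi * Complex.exp (Complex.I * m * Real.pi / 4) /
    (Complex.Gamma ((μ + 3 + (|m| : ℤ)) / 4) * Complex.Gamma ((μ + 3 - (|m| : ℤ)) / 4))

end PoissonSL2

end

namespace PoissonSL2

open Filter Topology MeasureTheory

/-! Put σ = (μ-1)/2. Since (k_θ b_u)⁻¹ k_φ = b_{-u} k_{φ-θ}, rotating the variable of integration
splits off e^{imθ} and leaves a function of u alone, `angIntegral`: the integral of |A|^σ |B|^σ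
e^{imα}, with signs, where (A, B) is the first column of b_{-u} k_α.

Two relations determine it. Differentiating in u gives ∂A = -B and ∂B = -A, so the derivative at
level σ involves level σ and level σ-1 with both parities flipped, that is, with ξ replaced by ξ+1
(`hasDerivAt_angIntegral`). Integrating ∂²/∂α² of the kernel against e^{imα} links the levels σ, σ-1
and σ-2 (`angIntegral_recurrence`). Eliminating the lower levels shows that cosh^{σ+1}(2u) times the
integral solves a linear second-order equation (`isTanhSol_scaledIntegral`). In the variable t =
tanh 2u this is (1-t²)y'' - (2s+1)ty' - (s² - m²/4)y = 0 with s = σ+1, whose even and odd solutions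
are Gauss series in t². Pfaff's transformation, proved here by uniqueness of the solution regular at
0, identifies them with the Jacobi functions φ and ψ up to powers of cosh.

It remains to find the value and the derivative at u = 0. The derivative is itself a base point
value, at level σ-1 and parity ξ+1; this is the origin of ω^{ξ+1} and c_m(μ-2). At u = 0 the circle
splits into four quarters, whose signs add up to ω, and each contributes the same moment of (cos α
sin α)^σ e^{imα} (`angIntegral_zero`). The moment follows from beta integrals for small m and a
recurrence in m (`trigMoment_eq`).

The argument needs Re σ > 3, where the kernels at levels σ, σ-1 and σ-2 are continuous and those at
levels σ and σ-1 are differentiable. The right-hand side divided by Γ(σ+1) is entire in μ, while the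
integral divided by Γ is holomorphic for Re μ > -1. The identity theorem on that half-plane turns
the formula into the required continuation. -/

/-! ### Power series on the unit disc -/

/-- The coefficients `f` define a power series that converges on the open unit disc. -/
def UnitRadius (f : ℕ → ℂ) : Prop :=
  ∀ r : ℝ, 0 ≤ r → r < 1 → Summable fun n => ‖f n‖ * r ^ n

/-- The coefficients of the derivative of a power series. -/
def derivCoeff (f : ℕ → ℂ) (n : ℕ) : ℂ := (n + 1) * f (n + 1)

/-- Absorbs the factor n produced by differentiation into a slightly larger radius ρ. -/
theorem nat_mul_pow_le {r ρ : ℝ} (hr : 0 ≤ r) (hr1 : r ≤ 1) (h : r ≤ ρ) (n : ℕ) :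
    n * (ρ - r) * r ^ n ≤ ρ ^ n := by
  induction n with
  | zero => simp
  | succ n ih =>
    have h1 : r ^ n ≤ ρ ^ n := by gcongr
    have h2 : r * r ^ n ≤ ρ ^ n := by nlinarith [pow_nonneg hr n]
    calc ((n + 1 : ℕ) : ℝ) * (ρ - r) * r ^ (n + 1)
        = r * (n * (ρ - r) * r ^ n) + (ρ - r) * (r * r ^ n) := by push_cast; ring
      _ ≤ r * ρ ^ n + (ρ - r) * ρ ^ n := by
        have := sub_nonneg.2 h
        gcongr
      _ = ρ ^ (n + 1) := by ring

theorem UnitRadius.nat_mul {f : ℕ → ℂ} (hf : UnitRadius f) :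
    UnitRadius fun n => n * f n := by
  intro r hr hr1
  have hρ : 0 < (1 + r) / 2 - r := by linarith
  refine Summable.of_nonneg_of_le (fun n => by positivity) (fun n => ?_)
    ((hf ((1 + r) / 2) (by linarith) (by linarith)).mul_left ((1 + r) / 2 - r)⁻¹)
  have h := nat_mul_pow_le hr hr1.le (ρ := (1 + r) / 2) (by linarith) n
  rw [norm_mul, Complex.norm_natCast, inv_mul_eq_div, le_div_iff₀ hρ]
  calc n * ‖f n‖ * r ^ n * ((1 + r) / 2 - r)
      = ‖f n‖ * (n * ((1 + r) / 2 - r) * r ^ n) := by ring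
    _ ≤ _ := by gcongr

theorem UnitRadius.succ {f : ℕ → ℂ} (hf : UnitRadius f) : UnitRadius fun n => f (n + 1) := by
  intro r hr hr1
  rcases hr.eq_or_lt with rfl | hr0
  · refine summable_of_ne_finset_zero (s := {0}) fun n hn => ?_
    simp at hn
    simp [hn]
  · have := ((summable_nat_add_iff 1).2 (hf r hr hr1)).mul_left r⁻¹
    refine this.congr fun n => ?_
    rw [pow_succ]; field_simp

theorem UnitRadius.deriv_coeff {f : ℕ → ℂ} (hf : UnitRadius f) : UnitRadius (derivCoeff f) := by
  have := hf.nat_mul.succ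
  simpa [derivCoeff, UnitRadius] using this

theorem UnitRadius.hasSum {f : ℕ → ℂ} (hf : UnitRadius f) {z : ℂ} (hz : ‖z‖ < 1) :
    HasSum (fun n => f n * z ^ n) (∑' n, f n * z ^ n) := by
  refine (Summable.of_norm ?_).hasSum
  simpa using hf ‖z‖ (norm_nonneg z) hz

theorem UnitRadius.hasDerivAt {f : ℕ → ℂ} (hf : UnitRadius f) {z : ℂ} (hz : ‖z‖ < 1) :
    HasDerivAt (fun z : ℂ => ∑' n : ℕ, f n * z ^ n) (∑' n, derivCoeff f n * z ^ n) z := by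
  obtain ⟨r, hzr, hr1⟩ := exists_between hz
  have hr : 0 ≤ r := (norm_nonneg z).trans hzr.le
  have key := hasDerivAt_tsum_of_isPreconnected (𝕜 := ℂ) (F := ℂ)
    (u := fun n : ℕ => ‖(n : ℂ) * f n‖ * r ^ (n - 1)) (g := fun (n : ℕ) z => f n * z ^ n)
    (g' := fun (n : ℕ) z => f n * (n * z ^ (n - 1))) (t := Metric.ball 0 r) (y₀ := 0) (y := z)
    ?_ Metric.isOpen_ball (convex_ball (0 : ℂ) r).isPreconnected
    (fun n y _ => (hasDerivAt_pow n y).const_mul _) (fun n y hy => ?_)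
    (by simpa using (norm_nonneg z).trans_lt hzr) ?_ (by simpa using hzr)
  · rw [show ∑' n : ℕ, derivCoeff f n * z ^ n = ∑' n : ℕ, f n * (n * z ^ (n - 1)) from ?_]
    · exact key
    rw [eq_comm, tsum_eq_zero_add']
    · simp only [CharP.cast_eq_zero, zero_mul, mul_zero, zero_add]
      refine tsum_congr fun n => ?_
      simp [derivCoeff]; ring
    · have := (hf.deriv_coeff.hasSum hz).summable
      refine this.congr fun n => ?_
      simp [derivCoeff]; ring
  · rw [← summable_nat_add_iff 1]
    simpa using hf.nat_mul.succ r hr hr1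
  · have hy' : ‖y‖ ≤ r := by simpa using (Metric.mem_ball.1 hy).le
    rw [norm_mul, norm_mul, norm_mul, norm_pow]
    calc ‖f n‖ * (‖(n : ℂ)‖ * ‖y‖ ^ (n - 1)) = ‖(n : ℂ)‖ * ‖f n‖ * ‖y‖ ^ (n - 1) := by ring
      _ ≤ _ := by gcongr
  · simpa using (hf.hasSum (z := 0) (by simp)).summable

theorem hasSum_mul_of_succ {g : ℕ → ℂ} {z D : ℂ} (h0 : g 0 = 0)
    (h : HasSum (fun n => g (n + 1) * z ^ n) D) : HasSum (fun n => g n * z ^ n) (z * D) := by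
  rw [← hasSum_nat_add_iff' 1]
  simp only [Finset.range_one, Finset.sum_singleton, h0, zero_mul, sub_zero]
  exact (h.mul_left z).congr_fun fun n => by ring

/-- The hypergeometric differential equation for a power series, from the recurrence for its
coefficients. -/
theorem UnitRadius.hypergeometric_ode {f : ℕ → ℂ} (hf : UnitRadius f) {a b c : ℂ}
    (hrec : ∀ n : ℕ, (n + 1) * (c + n) * f (n + 1) = (a + n) * (b + n) * f n) {z : ℂ}
    (hz : ‖z‖ < 1) :
    z * (1 - z) * (∑' n, derivCoeff (derivCoeff f) n * z ^ n) +
      (c - (a + b + 1) * z) * (∑' n, derivCoeff f n * z ^ n) -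
      a * b * (∑' n, f n * z ^ n) = 0 := by
  have h0 := hf.hasSum hz
  have h1 := hf.deriv_coeff.hasSum hz
  have h2 := hf.deriv_coeff.deriv_coeff.hasSum hz
  -- With f the sum of the series, these are the expansions of z f', z f'' and z² f''; the equation
  -- then holds coefficient by coefficient, by the recurrence.
  have h1' := hasSum_mul_of_succ (g := fun n => n * f n) (z := z) (by simp)
    (h1.congr_fun fun n => by simp [derivCoeff])
  have h2' := hasSum_mul_of_succ (g := fun n => n * derivCoeff f n) (z := z) (by simp)
    (h2.congr_fun fun n => by simp [derivCoeff])
  have h2'' := hasSum_mul_of_succ (g := fun n => n * ((n - 1) * f n)) (z := z) (by simp)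
    (h2'.congr_fun fun n => by simp only [derivCoeff]; push_cast; ring)
  have key := (((h2'.sub h2'').add (h1.mul_left c)).sub (h1'.mul_left (a + b + 1))).sub
    (h0.mul_left (a * b))
  have hz0 := key.unique ((hasSum_zero (α := ℂ) (β := ℕ)).congr_fun fun n => ?_)
  · linear_combination hz0
  · simp only [derivCoeff]
    linear_combination z ^ n * hrec n


-- The Gauss series: radius, differential equation, dependence on parameters

local notation "coef" => ordinaryHypergeometricCoefficient

theorem hypCoeff_succ (a b : ℂ) {c : ℂ} (hc : ∀ n : ℕ, c + n ≠ 0) (n : ℕ) :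
    (n + 1) * (c + n) * coef a b c (n + 1) = (a + n) * (b + n) * coef a b c n := by
  have h1 : (n : ℂ) + 1 ≠ 0 := Nat.cast_add_one_ne_zero n
  have h2 := hc n
  have h3 : ((n.factorial : ℕ) : ℂ) ≠ 0 := by exact_mod_cast n.factorial_ne_zero
  simp only [ordinaryHypergeometricCoefficient, ascPochhammer_succ_eval, Nat.factorial_succ,
    mul_inv]
  push_cast
  field_simp

theorem norm_ascPochhammer_eval_le {a : ℂ} {A : ℝ} (h : ‖a‖ ≤ A) (n : ℕ) :
    ‖(ascPochhammer ℂ n).eval a‖ ≤ ‖(ascPochhammer ℂ n).eval (A : ℂ)‖ := by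
  have hA : 0 ≤ A := (norm_nonneg a).trans h
  induction n with
  | zero => simp
  | succ n ih =>
    have h1 : ‖(A : ℂ) + n‖ = A + n := by
      rw [show (A : ℂ) + n = ((A + n : ℝ) : ℂ) by push_cast; rfl, Complex.norm_real,
        Real.norm_of_nonneg (by positivity)]
    have h2 : ‖a + n‖ ≤ A + n := (norm_add_le _ _).trans (by simpa using h)
    rw [ascPochhammer_succ_eval, ascPochhammer_succ_eval, norm_mul, norm_mul, h1]
    gcongr

theorem norm_hypCoeff_le {a b c : ℂ} {A B : ℝ} (ha : ‖a‖ ≤ A) (hb : ‖b‖ ≤ B) (n : ℕ) :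
    ‖coef a b c n‖ ≤ ‖coef (A : ℂ) (B : ℂ) c n‖ := by
  simp only [ordinaryHypergeometricCoefficient, norm_mul]
  gcongr ‖_‖ * ?_ * ?_ * ‖_‖
  · exact norm_ascPochhammer_eval_le ha n
  · exact norm_ascPochhammer_eval_le hb n

theorem unitRadius_hypCoeff_of_pos {A B : ℝ} (hA : 0 < A) (hB : 0 < B) {c : ℂ}
    (hc : ∀ n : ℕ, c + n ≠ 0) : UnitRadius (coef (A : ℂ) (B : ℂ) c) := by
  intro r hr hr1
  lift r to NNReal using hr
  have key : ∀ {A : ℝ}, 0 < A → ∀ n : ℕ, (n : ℂ) ≠ -(A : ℂ) := fun {A} hA n h => by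
    have := congrArg Complex.re h
    simp at this
    have hn : (0 : ℝ) ≤ n := n.cast_nonneg
    linarith
  have hrad := ordinaryHypergeometricSeries_radius_eq_one ℂ (A : ℂ) (B : ℂ) c
    (fun n => ⟨key hA n, key hB n, fun h => hc n (by rw [h]; ring)⟩)
  have := (ordinaryHypergeometricSeries ℂ (A : ℂ) (B : ℂ) c).summable_norm_mul_pow
    (r := r) (by rw [hrad]; exact_mod_cast hr1)
  simpa [ordinaryHypergeometricSeries, FormalMultilinearSeries.ofScalars_norm] using this

/-- If a or b is a nonpositive integer the series terminates and its radius is not 1. Comparison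
with the positive parameters ‖a‖ + 1 and ‖b‖ + 1 treats all cases at once. -/
theorem unitRadius_hypCoeff (a b : ℂ) {c : ℂ} (hc : ∀ n : ℕ, c + n ≠ 0) :
    UnitRadius (coef a b c) := fun r hr hr1 => by
  refine Summable.of_nonneg_of_le (fun n => by positivity) (fun n => ?_)
    (unitRadius_hypCoeff_of_pos (A := ‖a‖ + 1) (B := ‖b‖ + 1) (by positivity) (by positivity)
      hc r hr hr1)
  gcongr
  exact norm_hypCoeff_le (by linarith) (by linarith) n

theorem hyp_eq_tsum (a b c z : ℂ) :
    ordinaryHypergeometric a b c z = ∑' n : ℕ, coef a b c n * z ^ n := by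
  simp only [ordinaryHypergeometric_eq_tsum, smul_eq_mul]

/-- The derivative of the hypergeometric series. -/
noncomputable def hypD (a b c z : ℂ) : ℂ := ∑' n : ℕ, derivCoeff (coef a b c) n * z ^ n

/-- The second derivative of the hypergeometric series. -/
noncomputable def hypDD (a b c z : ℂ) : ℂ := ∑' n : ℕ, derivCoeff (derivCoeff (coef a b c)) n * z ^ n

theorem hasDerivAt_hyp (a b : ℂ) {c : ℂ} (hc : ∀ n : ℕ, c + n ≠ 0) {z : ℂ}
    (hz : ‖z‖ < 1) :
    HasDerivAt (fun z : ℂ => ordinaryHypergeometric a b c z) (hypD a b c z) z := by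
  simp only [hyp_eq_tsum]
  exact (unitRadius_hypCoeff a b hc).hasDerivAt hz

theorem hasDerivAt_hypD (a b : ℂ) {c : ℂ} (hc : ∀ n : ℕ, c + n ≠ 0) {z : ℂ}
    (hz : ‖z‖ < 1) : HasDerivAt (hypD a b c) (hypDD a b c z) z :=
  (unitRadius_hypCoeff a b hc).deriv_coeff.hasDerivAt hz

theorem hyp_ode (a b : ℂ) {c : ℂ} (hc : ∀ n : ℕ, c + n ≠ 0) {z : ℂ}
    (hz : ‖z‖ < 1) : z * (1 - z) * hypDD a b c z + (c - (a + b + 1) * z) * hypD a b c z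
    - a * b * ordinaryHypergeometric a b c z = 0 := by
  rw [hyp_eq_tsum]
  exact (unitRadius_hypCoeff a b hc).hypergeometric_ode (hypCoeff_succ a b hc) hz

theorem analyticAt_hyp (a b : ℂ) {c : ℂ} (hc : ∀ n : ℕ, c + n ≠ 0) {z : ℂ}
    (hz : ‖z‖ < 1) : AnalyticAt ℂ (fun z : ℂ => ordinaryHypergeometric a b c z) z := by
  have ho : DifferentiableOn ℂ (fun z : ℂ => ordinaryHypergeometric a b c z)
      (Metric.ball 0 1) := fun w hw =>
    (hasDerivAt_hyp a b hc (by simpa using hw)).differentiableAt.differentiableWithinAt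
  exact ho.analyticAt (Metric.isOpen_ball.mem_nhds (by simpa using hz))

/-- The hypergeometric function depends holomorphically on its first two parameters. -/
theorem differentiable_hyp_param {a b : ℂ → ℂ} (ha : Differentiable ℂ a)
    (hb : Differentiable ℂ b) {c z : ℂ} (hc : ∀ n : ℕ, c + n ≠ 0) (hz : ‖z‖ < 1) :
    Differentiable ℂ fun ν => ordinaryHypergeometric (a ν) (b ν) c z := by
  intro ν₀
  -- Near ν₀ both parameters stay bounded, so a single positive-parameter series dominates and
  -- convergence is locally uniform in ν.
  obtain ⟨s, hs, hso, hν⟩ : ∃ s : Set ℂ, (∀ ν ∈ s, ‖a ν‖ ≤ ‖a ν₀‖ + 1 ∧ ‖b ν‖ ≤ ‖b ν₀‖ + 1) ∧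
      IsOpen s ∧ ν₀ ∈ s := by
    refine ⟨{ν | ‖a ν‖ < ‖a ν₀‖ + 1} ∩ {ν | ‖b ν‖ < ‖b ν₀‖ + 1},
      fun ν hν => ⟨hν.1.le, hν.2.le⟩, ?_, by simp⟩
    exact (isOpen_lt ha.continuous.norm continuous_const).inter
      (isOpen_lt hb.continuous.norm continuous_const)
  have := Complex.differentiableOn_tsum_of_summable_norm (U := s)
    (F := fun (n : ℕ) (ν : ℂ) => coef (a ν) (b ν) c n * z ^ n)
    (unitRadius_hypCoeff_of_pos (A := ‖a ν₀‖ + 1) (B := ‖b ν₀‖ + 1) (by positivity)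
      (by positivity) hc ‖z‖ (norm_nonneg z) hz) (fun n => ?_) hso (fun n ν hν => ?_)
  · simpa only [hyp_eq_tsum] using (this.differentiableAt (hso.mem_nhds hν))
  · have h : ∀ {f : ℂ → ℂ}, Differentiable ℂ f →
        Differentiable ℂ fun ν => (ascPochhammer ℂ n).eval (f ν) := fun hf =>
      (ascPochhammer ℂ n).differentiable.comp hf
    exact (((((h ha).const_mul _).mul (h hb)).mul_const _).mul_const _).differentiableOn
  · rw [norm_mul, norm_pow]
    gcongr
    exact norm_hypCoeff_le (hs ν hν).1 (hs ν hν).2 n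

/-! ### Uniqueness at the origin and Pfaff's transformation -/

/-- A solution of the hypergeometric equation that is analytic at `0` and vanishes there is
zero near `0`. -/
theorem eventually_eq_zero_of_hypergeometric_ode {a b c : ℂ} (hc : ∀ n : ℕ, c + n ≠ 0)
    {f : ℂ → ℂ} (hf : AnalyticAt ℂ f 0) (h0 : f 0 = 0)
    (hode : ∀ᶠ z in 𝓝 (0 : ℂ), z * (1 - z) * deriv (deriv f) z +
      (c - (a + b + 1) * z) * deriv f z - a * b * f z = 0) :
    ∀ᶠ z in 𝓝 (0 : ℂ), f z = 0 := by
  by_contra hne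
  -- Indicial argument. Writing f = z^(k+1) g with g(0) ≠ 0 and dividing the equation by z^k leaves
  -- (c+k)(k+1) g(0) = 0 at the origin, which the hypothesis on c forbids. Working with z f''
  -- instead of f'' keeps the power z^k when k = 0.
  obtain ⟨n, g, hg, hg0, hfg⟩ := hf.exists_eventuallyEq_pow_smul_nonzero_iff.2 hne
  simp only [sub_zero, smul_eq_mul] at hfg
  rcases n with _ | k
  · apply hg0
    have := hfg.self_of_nhds
    simpa [h0] using this.symm
  set h : ℂ → ℂ := fun z => (k + 1) * g z + z * deriv g z with hh
  have hha : AnalyticAt ℂ h 0 := by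
    have := hg.deriv
    fun_prop
  have hd : ∀ᶠ z in 𝓝 (0 : ℂ), deriv f z = z ^ k * h z := by
    filter_upwards [hfg.eventually_nhds, hg.eventually_analyticAt] with z hz hgz
    rw [EventuallyEq.deriv_eq hz]
    have := ((hasDerivAt_pow (k + 1) z).mul hgz.differentiableAt.hasDerivAt).deriv
    simp only [hh]
    erw [this]
    simp only [Nat.add_sub_cancel]
    push_cast; ring
  have hdd : ∀ᶠ z in 𝓝 (0 : ℂ), z * deriv (deriv f) z = z ^ k * (k * h z + z * deriv h z) := by
    filter_upwards [hd.eventually_nhds, hha.eventually_analyticAt] with z hz hgz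
    rw [EventuallyEq.deriv_eq hz]
    have := ((hasDerivAt_pow k z).mul hgz.differentiableAt.hasDerivAt).deriv
    erw [this]
    rcases k with _ | k
    · simp
    · simp only [Nat.add_sub_cancel]
      push_cast; ring
  set e : ℂ → ℂ := fun z => (1 - z) * (k * h z + z * deriv h z) + (c - (a + b + 1) * z) * h z -
    a * b * (z * g z) with he
  have hea : ContinuousAt e 0 := by
    have := hha.deriv.continuousAt
    have := hha.continuousAt
    have := hg.continuousAt
    fun_prop
  have hez : ∀ᶠ z in 𝓝[≠] (0 : ℂ), e z = 0 := by
    filter_upwards [nhdsWithin_le_nhds hd, nhdsWithin_le_nhds hdd, nhdsWithin_le_nhds hode,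
      nhdsWithin_le_nhds hfg, self_mem_nhdsWithin] with z h1 h2 h3 h4 h5
    have h6 : z ^ k * e z = 0 := by
      rw [h1, h4] at h3
      rw [he]
      linear_combination h3 - (1 - z) * h2
    exact (mul_eq_zero.1 h6).resolve_left (pow_ne_zero _ h5)
  have he0 : e 0 = 0 := by
    have h1 : Tendsto e (𝓝[≠] 0) (𝓝 (e 0)) := hea.tendsto.mono_left nhdsWithin_le_nhds
    have h2 : Tendsto e (𝓝[≠] 0) (𝓝 0) := tendsto_const_nhds.congr' (hez.mono fun z hz => hz.symm)
    exact tendsto_nhds_unique h1 h2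
  have : (c + k) * ((k + 1) * g 0) = 0 := by
    have h1 : e 0 = (c + k) * ((k + 1) * g 0) := by simp [he, hh]; ring
    rw [← h1, he0]
  exact mul_ne_zero (hc k) (mul_ne_zero (Nat.cast_add_one_ne_zero k) hg0) this

/-- The right-hand side of Pfaff's transformation. -/
noncomputable def pfaff (a b c z : ℂ) : ℂ :=
  (1 - z) ^ (-a) * ordinaryHypergeometric a (c - b) c (z / (z - 1))

/-- The half-plane consists of the points closer to 0 than to 1. -/
theorem norm_div_sub_one_lt {z : ℂ} (hz : z.re < 1 / 2) : ‖z / (z - 1)‖ < 1 := by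
  have h1 : z - 1 ≠ 0 := fun h => by
    have := congrArg Complex.re h
    simp at this
    linarith
  rw [norm_div, div_lt_one (norm_pos_iff.2 h1), ← sq_lt_sq₀ (norm_nonneg _) (norm_nonneg _),
    ← Complex.normSq_eq_norm_sq, ← Complex.normSq_eq_norm_sq, Complex.normSq_apply,
    Complex.normSq_apply]
  simp
  nlinarith

theorem hasDerivAt_div_sub_one {z : ℂ} (hz : z - 1 ≠ 0) :
    HasDerivAt (fun z : ℂ => z / (z - 1)) (-(1 / (z - 1) ^ 2)) z := by
  have := (hasDerivAt_id z).div ((hasDerivAt_id z).sub_const 1) hz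
  refine this.congr_deriv ?_
  simp only [id]
  field_simp; ring

theorem hasDerivAt_one_sub_cpow {z : ℂ} (hz : z.re < 1) (s : ℂ) :
    HasDerivAt (fun z : ℂ => (1 - z) ^ s) (-s * (1 - z) ^ (s - 1)) z := by
  have := ((hasDerivAt_id z).const_sub 1).cpow_const (c := s)
    (Or.inl (by simpa using hz))
  refine this.congr_deriv ?_
  simp only [id]
  ring

section
variable (a b : ℂ) {c : ℂ}

theorem hasDerivAt_pfaff (hc : ∀ n : ℕ, c + n ≠ 0) {z : ℂ} (hz : z.re < 1 / 2) :
    HasDerivAt (pfaff a b c) (a * (1 - z) ^ (-a - 1) *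
      ordinaryHypergeometric a (c - b) c (z / (z - 1)) -
      (1 - z) ^ (-a - 2) * hypD a (c - b) c (z / (z - 1))) z := by
  have h1 : z - 1 ≠ 0 := fun h => by
    have := congrArg Complex.re h
    simp at this
    linarith
  have h2 : 1 - z ≠ 0 := fun h => h1 (by linear_combination -h)
  have hF := (hasDerivAt_hyp a (c - b) hc (norm_div_sub_one_lt hz)).comp z
    (hasDerivAt_div_sub_one h1)
  have := (hasDerivAt_one_sub_cpow (by linarith) (-a)).mul hF
  refine this.congr_deriv ?_
  have e2 : (1 - z) ^ (-a - 2) = (1 - z) ^ (-a) / (z - 1) ^ 2 := by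
    rw [Complex.cpow_sub _ _ h2, show (2 : ℂ) = ((2 : ℕ) : ℂ) by norm_num, Complex.cpow_natCast]
    congr 1; ring
  rw [e2]
  simp only [Function.comp]
  ring

theorem hasDerivAt_deriv_pfaff (hc : ∀ n : ℕ, c + n ≠ 0) {z : ℂ} (hz : z.re < 1 / 2) :
    HasDerivAt (deriv (pfaff a b c)) (a * (a + 1) * (1 - z) ^ (-a - 2) *
      ordinaryHypergeometric a (c - b) c (z / (z - 1)) -
      (2 * a + 2) * (1 - z) ^ (-a - 3) * hypD a (c - b) c (z / (z - 1)) +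
      (1 - z) ^ (-a - 4) * hypDD a (c - b) c (z / (z - 1))) z := by
  have h1 : z - 1 ≠ 0 := fun h => by
    have := congrArg Complex.re h
    simp at this
    linarith
  have h2 : 1 - z ≠ 0 := fun h => h1 (by linear_combination -h)
  have hF := (hasDerivAt_hyp a (c - b) hc (norm_div_sub_one_lt hz)).comp z
    (hasDerivAt_div_sub_one h1)
  have hF' := (hasDerivAt_hypD a (c - b) hc (norm_div_sub_one_lt hz)).comp z
    (hasDerivAt_div_sub_one h1)
  have hev : deriv (pfaff a b c) =ᶠ[𝓝 z] fun z => a * (1 - z) ^ (-a - 1) *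
      ordinaryHypergeometric a (c - b) c (z / (z - 1)) -
      (1 - z) ^ (-a - 2) * hypD a (c - b) c (z / (z - 1)) := by
    filter_upwards [(isOpen_lt Complex.continuous_re continuous_const).mem_nhds hz] with w hw
    exact (hasDerivAt_pfaff a b hc hw).deriv
  have := (((hasDerivAt_one_sub_cpow (z := z) (by linarith) (-a - 1)).const_mul a).mul hF).sub
    ((hasDerivAt_one_sub_cpow (by linarith) (-a - 2)).mul hF')
  refine (this.congr_of_eventuallyEq hev).congr_deriv ?_
  have e : ∀ k : ℕ, (1 - z) ^ (-a - k) = (1 - z) ^ (-a) / (1 - z) ^ k := fun k => by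
    rw [Complex.cpow_sub _ _ h2, Complex.cpow_natCast]
  have e1 := e 1
  have e2 := e 2
  have e3 := e 3
  have e4 := e 4
  push_cast at e1 e2 e3 e4
  rw [show -a - 1 - 1 = -a - 2 by ring, show -a - 2 - 1 = -a - 3 by ring, e1, e2, e3, e4,
    show (z - 1) ^ 2 = (1 - z) ^ 2 by ring]
  simp only [Function.comp]
  field_simp
  ring

/-- The map z ↦ z/(z-1) fixes 0 and exchanges the singular points 1 and ∞; with the factor
(1-z)^(-a) it carries the equation for (a, c-b; c) to the one for (a, b; c). -/
theorem pfaff_ode (hc : ∀ n : ℕ, c + n ≠ 0) {z : ℂ} (hz : z.re < 1 / 2) :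
    z * (1 - z) * deriv (deriv (pfaff a b c)) z +
      (c - (a + b + 1) * z) * deriv (pfaff a b c) z - a * b * pfaff a b c z = 0 := by
  have h1 : z - 1 ≠ 0 := fun h => by
    have := congrArg Complex.re h
    simp at this
    linarith
  have h2 : 1 - z ≠ 0 := fun h => h1 (by linear_combination -h)
  rw [(hasDerivAt_pfaff a b hc hz).deriv, (hasDerivAt_deriv_pfaff a b hc hz).deriv, pfaff]
  have hode := hyp_ode a (c - b) hc (norm_div_sub_one_lt hz)
  set F := ordinaryHypergeometric a (c - b) c (z / (z - 1))
  set F1 := hypD a (c - b) c (z / (z - 1))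
  set F2 := hypDD a (c - b) c (z / (z - 1))
  have e : ∀ k : ℕ, (1 - z) ^ (-a - k) = (1 - z) ^ (-a) / (1 - z) ^ k := fun k => by
    rw [Complex.cpow_sub _ _ h2, Complex.cpow_natCast]
  have e1 := e 1
  have e2 := e 2
  have e3 := e 3
  have e4 := e 4
  push_cast at e1 e2 e3 e4
  rw [e1, e2, e3, e4]
  have hw : z / (z - 1) = -z / (1 - z) := by rw [← neg_sub, div_neg, neg_div]
  rw [hw] at hode
  set E := (1 - z) ^ (-a)
  field_simp at hode ⊢
  linear_combination (-E) * hode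

theorem analyticAt_pfaff (hc : ∀ n : ℕ, c + n ≠ 0) {z : ℂ} (hz : z.re < 1 / 2) :
    AnalyticAt ℂ (pfaff a b c) z := by
  have ho : IsOpen {z : ℂ | z.re < 1 / 2} := isOpen_lt Complex.continuous_re continuous_const
  have hd : DifferentiableOn ℂ (pfaff a b c) {z : ℂ | z.re < 1 / 2} := fun w hw =>
    (hasDerivAt_pfaff a b hc hw).differentiableAt.differentiableWithinAt
  exact hd.analyticAt (ho.mem_nhds hz)

/-- Pfaff's transformation near `0`. -/
theorem eventually_hyp_eq_pfaff (hc : ∀ n : ℕ, c + n ≠ 0) :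
    ∀ᶠ z in 𝓝 (0 : ℂ), ordinaryHypergeometric a b c z = pfaff a b c z := by
  have hz0 : (0 : ℂ).re < 1 / 2 := by simp
  have hn0 : ‖(0 : ℂ)‖ < 1 := by simp
  have ho : IsOpen {z : ℂ | z.re < 1 / 2} := isOpen_lt Complex.continuous_re continuous_const
  have hev : ∀ᶠ z in 𝓝 (0 : ℂ), z.re < 1 / 2 ∧ ‖z‖ < 1 :=
    Filter.Eventually.and (ho.mem_nhds hz0) ((isOpen_lt continuous_norm continuous_const).mem_nhds hn0)
  have hd : ∀ᶠ z in 𝓝 (0 : ℂ), deriv (fun z => ordinaryHypergeometric a b c z - pfaff a b c z) z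
      = hypD a b c z - deriv (pfaff a b c) z := by
    filter_upwards [hev] with z hz
    exact ((hasDerivAt_hyp a b hc hz.2).sub
      (hasDerivAt_pfaff a b hc hz.1).differentiableAt.hasDerivAt).deriv
  -- The difference of the two sides solves the same linear equation, and it vanishes at 0 because
  -- both sides equal 1 there.
  have key := eventually_eq_zero_of_hypergeometric_ode (a := a) (b := b) hc
    ((analyticAt_hyp a b hc hn0).sub (analyticAt_pfaff a b hc hz0)) (by simp [pfaff]) ?_
  · filter_upwards [key] with z hz
    exact sub_eq_zero.1 hz
  · filter_upwards [hev, hd.eventually_nhds] with z hz hdz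
    have h2 : deriv (deriv fun z => ordinaryHypergeometric a b c z - pfaff a b c z) z
        = hypDD a b c z - deriv (deriv (pfaff a b c)) z := by
      rw [EventuallyEq.deriv_eq hdz]
      exact ((hasDerivAt_hypD a b hc hz.2).sub
        (hasDerivAt_deriv_pfaff a b hc hz.1).differentiableAt.hasDerivAt).deriv
    have h1 := hdz.self_of_nhds
    erw [h2, h1]
    simp only [Pi.sub_apply]
    linear_combination hyp_ode a b hc hz.2 - pfaff_ode a b hc hz.1

theorem analyticAt_comp_ofReal {f : ℂ → ℂ} {x : ℝ} (hf : AnalyticAt ℂ f x) :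
    AnalyticAt ℝ (fun x : ℝ => f x) x :=
  (hf.restrictScalars (𝕜 := ℝ)).comp (Complex.ofRealCLM.analyticAt x)

/-- Gauss's hypergeometric function on `(-∞, 1/2)`, by Pfaff's transformation. -/
theorem hyp2F1_eq_pfaff (hc : ∀ n : ℕ, c + n ≠ 0) {x : ℝ} (hx : x < 1 / 2) :
    hyp2F1 a b c x = pfaff a b c x := by
  have hA : ∀ y : ℝ, |y| < 1 → AnalyticAt ℝ (fun y : ℝ => ordinaryHypergeometric a b c (y : ℂ)) y :=
    fun y hy => analyticAt_comp_ofReal (f := fun z : ℂ => ordinaryHypergeometric a b c z)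
      (analyticAt_hyp a b hc (by simpa using hy))
  have hB : ∀ y : ℝ, y < 1 / 2 → AnalyticAt ℝ (fun y : ℝ => pfaff a b c (y : ℂ)) y :=
    fun y hy => analyticAt_comp_ofReal (analyticAt_pfaff a b hc (by simpa using hy))
  have heq : Set.EqOn (fun y : ℝ => ordinaryHypergeometric a b c (y : ℂ))
      (fun y : ℝ => pfaff a b c (y : ℂ)) (Set.Ioo (-1) (1 / 2)) := by
    refine AnalyticOnNhd.eqOn_of_preconnected_of_eventuallyEq (z₀ := (0 : ℝ))
      (fun y hy => hA y (abs_lt.2 ⟨hy.1, by linarith [hy.2]⟩)) (fun y hy => hB y hy.2)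
      isPreconnected_Ioo (by norm_num) ?_
    have := (Complex.continuous_ofReal.tendsto 0).eventually
      (by simpa using eventually_hyp_eq_pfaff a b hc)
    exact this
  classical
  -- Neither expression suffices on (-∞, 1): the series is used on (-1, 1) and Pfaff's form on (-∞,
  -- 1/2). They agree on the overlap (-1, 1/2), so the glued function is analytic and is the
  -- continuation.
  set F : ℝ → ℂ := fun y => if y < 0 then pfaff a b c y else ordinaryHypergeometric a b c (y : ℂ)
    with hF
  have h1 : ∀ y : ℝ, y < 1 / 2 → F y = pfaff a b c y := fun y hy => by
    simp only [hF]
    split_ifs with h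
    · rfl
    · exact heq ⟨by linarith, hy⟩
  have h2 : ∀ y : ℝ, -1 < y → F y = ordinaryHypergeometric a b c (y : ℂ) := fun y hy => by
    simp only [hF]
    split_ifs with h
    · exact (heq ⟨hy, by linarith⟩).symm
    · rfl
  rw [hyp2F1_eq (F := F) ⟨fun y hy => ?_, fun y hy => h2 y (abs_lt.1 hy).1⟩ (by linarith), h1 x hx]
  rcases lt_or_ge y (1 / 2) with h | h
  · refine (hB y h).congr ?_
    filter_upwards [Iio_mem_nhds h] with w hw using (h1 w hw).symm
  · refine (hA y (abs_lt.2 ⟨by linarith, hy⟩)).congr ?_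
    filter_upwards [Ioi_mem_nhds (show -1 < y by linarith)] with w hw using (h2 w hw).symm

end

/-! ### Even and odd solutions on the disc -/

theorem half_add_nat_ne_zero (n : ℕ) : (1 / 2 : ℂ) + n ≠ 0 := fun h => by
  have := congrArg Complex.re h
  simp at this
  have hn : (0 : ℝ) ≤ n := n.cast_nonneg
  linarith

theorem three_halves_add_nat_ne_zero (n : ℕ) : (3 / 2 : ℂ) + n ≠ 0 := fun h => by
  have := congrArg Complex.re h
  simp at this
  have hn : (0 : ℝ) ≤ n := n.cast_nonneg
  linarith

/-- The even solution of `(1 - t²) y'' - (2s + 1) t y' - (s² - m²/4) y = 0`. -/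
noncomputable def evenSol (m : ℤ) (s t : ℂ) : ℂ :=
  ordinaryHypergeometric ((s + m / 2) / 2) ((s - m / 2) / 2) (1 / 2 : ℂ) (t ^ 2)

/-- The odd solution of `(1 - t²) y'' - (2s + 1) t y' - (s² - m²/4) y = 0`. -/
noncomputable def oddSol (m : ℤ) (s t : ℂ) : ℂ :=
  t * ordinaryHypergeometric ((s + 1 + m / 2) / 2) ((s + 1 - m / 2) / 2) (3 / 2 : ℂ) (t ^ 2)

theorem evenSol_zero (m : ℤ) (s : ℂ) : evenSol m s 0 = 1 := by simp [evenSol]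

theorem oddSol_zero (m : ℤ) (s : ℂ) : oddSol m s 0 = 0 := by simp [oddSol]

/-- `y` solves `(1 - t²) y'' - (2s + 1) t y' - (s² - m²/4) y = 0` on the unit disc, and `y₁` is its
derivative. -/
def IsDiscSol (m : ℤ) (s : ℂ) (y y₁ : ℂ → ℂ) : Prop :=
  ∀ t : ℂ, ‖t‖ < 1 → HasDerivAt y (y₁ t) t ∧ ∃ d : ℂ, HasDerivAt y₁ d t ∧
    (1 - t ^ 2) * d = (2 * s + 1) * t * y₁ t + (s ^ 2 - (m : ℂ) ^ 2 / 4) * y t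

theorem norm_sq_lt_one {t : ℂ} (ht : ‖t‖ < 1) : ‖t ^ 2‖ < 1 := by
  rw [norm_pow]
  exact pow_lt_one₀ (norm_nonneg t) ht two_ne_zero

theorem hasDerivAt_sq (t : ℂ) : HasDerivAt (fun t : ℂ => t ^ 2) (2 * t) t := by
  simpa using hasDerivAt_pow 2 t

/-- The substitution z = t² gives the hypergeometric equation with c = 1/2, a + b = s and 4ab = s² -
m²/4. -/
theorem isDiscSol_evenSol (m : ℤ) (s : ℂ) : IsDiscSol m s (evenSol m s)
    (fun t => 2 * t * hypD ((s + m / 2) / 2) ((s - m / 2) / 2) (1 / 2) (t ^ 2)) := by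
  intro t ht
  have hc := half_add_nat_ne_zero
  set a : ℂ := (s + m / 2) / 2 with ha
  set b : ℂ := (s - m / 2) / 2 with hb
  have h1 := (hasDerivAt_hyp a b hc (norm_sq_lt_one ht)).comp t (hasDerivAt_sq t)
  have h2 := (hasDerivAt_hypD a b hc (norm_sq_lt_one ht)).comp t (hasDerivAt_sq t)
  refine ⟨h1.congr_deriv (by ring), _, ((hasDerivAt_id t).const_mul 2).mul h2, ?_⟩
  have hode := hyp_ode a b hc (norm_sq_lt_one ht)
  simp only [evenSol, id, ← ha, ← hb]
  rw [show s ^ 2 - (m : ℂ) ^ 2 / 4 = 4 * (a * b) by rw [ha, hb]; ring]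
  rw [show s = a + b by rw [ha, hb]; ring]
  linear_combination 4 * hode

/-- After the factor t is removed, z = t² gives the hypergeometric equation with c = 3/2, a + b = s
+ 1 and 4ab = (s+1)² - m²/4. -/
theorem isDiscSol_oddSol (m : ℤ) (s : ℂ) : IsDiscSol m s (oddSol m s)
    (fun t => ordinaryHypergeometric ((s + 1 + m / 2) / 2) ((s + 1 - m / 2) / 2) (3 / 2 : ℂ) (t ^ 2)
      + 2 * t ^ 2 * hypD ((s + 1 + m / 2) / 2) ((s + 1 - m / 2) / 2) (3 / 2) (t ^ 2)) := by
  intro t ht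
  have hc := three_halves_add_nat_ne_zero
  set a : ℂ := (s + 1 + m / 2) / 2 with ha
  set b : ℂ := (s + 1 - m / 2) / 2 with hb
  have h1 := (hasDerivAt_hyp a b hc (norm_sq_lt_one ht)).comp t (hasDerivAt_sq t)
  have h2 := (hasDerivAt_hypD a b hc (norm_sq_lt_one ht)).comp t (hasDerivAt_sq t)
  refine ⟨((hasDerivAt_id t).mul h1).congr_deriv ?_, _,
    h1.add (((hasDerivAt_sq t).const_mul 2).mul h2), ?_⟩
  · simp only [Function.comp, id]
    ring
  have hode := hyp_ode a b hc (norm_sq_lt_one ht)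
  simp only [oddSol, ← ha, ← hb]
  rw [show s ^ 2 - (m : ℂ) ^ 2 / 4 = 4 * (a * b) - 2 * (a + b) + 1 by rw [ha, hb]; ring]
  rw [show s = a + b - 1 by rw [ha, hb]; ring]
  linear_combination 4 * t * hode

theorem differentiable_evenSol (m : ℤ) {s : ℂ → ℂ} (hs : Differentiable ℂ s) {t : ℂ}
    (ht : ‖t‖ < 1) : Differentiable ℂ fun ν => evenSol m (s ν) t :=
  differentiable_hyp_param (by fun_prop) (by fun_prop) half_add_nat_ne_zero (norm_sq_lt_one ht)

theorem differentiable_oddSol (m : ℤ) {s : ℂ → ℂ} (hs : Differentiable ℂ s) {t : ℂ}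
    (ht : ‖t‖ < 1) : Differentiable ℂ fun ν => oddSol m (s ν) t :=
  (differentiable_hyp_param (by fun_prop) (by fun_prop) three_halves_add_nat_ne_zero
    (norm_sq_lt_one ht)).const_mul t

/-! ### The equation in the variable u, with t = tanh 2u -/

theorem norm_sinh_div_cosh_lt (v : ℝ) : ‖(Real.sinh v : ℂ) / (Real.cosh v : ℂ)‖ < 1 := by
  have h := Real.cosh_pos v
  rw [norm_div, Complex.norm_real, Complex.norm_real, Real.norm_of_nonneg h.le, div_lt_one h,
    Real.norm_eq_abs]
  exact abs_lt_of_sq_lt_sq (by nlinarith [Real.cosh_sq v]) h.le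

theorem cosh_ofReal_ne_zero (v : ℝ) : (Real.cosh v : ℂ) ≠ 0 := by
  exact_mod_cast (Real.cosh_pos v).ne'

theorem cosh_sq_ofReal (v : ℝ) : (Real.cosh v : ℂ) ^ 2 = (Real.sinh v : ℂ) ^ 2 + 1 := by
  exact_mod_cast Real.cosh_sq v

theorem hasDerivAt_cosh_two_mul (u : ℝ) :
    HasDerivAt (fun u : ℝ => (Real.cosh (2 * u) : ℂ)) (2 * (Real.sinh (2 * u) : ℂ)) u := by
  have := (((hasDerivAt_id u).const_mul 2).cosh).ofReal_comp
  refine this.congr_deriv ?_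
  simp [mul_comm]

theorem hasDerivAt_sinh_two_mul (u : ℝ) :
    HasDerivAt (fun u : ℝ => (Real.sinh (2 * u) : ℂ)) (2 * (Real.cosh (2 * u) : ℂ)) u := by
  have := (((hasDerivAt_id u).const_mul 2).sinh).ofReal_comp
  refine this.congr_deriv ?_
  simp [mul_comm]

theorem hasDerivAt_tanh_two_mul (u : ℝ) :
    HasDerivAt (fun u : ℝ => (Real.sinh (2 * u) : ℂ) / (Real.cosh (2 * u) : ℂ))
      (2 / (Real.cosh (2 * u) : ℂ) ^ 2) u := by
  have h := cosh_ofReal_ne_zero (2 * u)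
  refine ((hasDerivAt_sinh_two_mul u).div (hasDerivAt_cosh_two_mul u) h).congr_deriv ?_
  field_simp
  linear_combination cosh_sq_ofReal (2 * u)

/-- `y'' = 2κ tanh(2u) y' + lam / cosh²(2u) y`, and `z = y'`. -/
def IsTanhSol (κ lam : ℂ) (y z : ℝ → ℂ) : Prop :=
  ∀ u : ℝ, HasDerivAt y (z u) u ∧
    HasDerivAt z (2 * κ * ((Real.sinh (2 * u) : ℂ) / (Real.cosh (2 * u) : ℂ)) * z u +
      lam / (Real.cosh (2 * u) : ℂ) ^ 2 * y u) u

/-- For t = tanh 2u one has dt/du = 2(1-t²) = 2/cosh²(2u). The whole real line maps into (-1, 1),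
and the singular points t = ±1 go to infinity. -/
theorem IsDiscSol.isTanhSol {m : ℤ} {s : ℂ} {y y₁ : ℂ → ℂ} (h : IsDiscSol m s y y₁) :
    IsTanhSol (2 * s - 1) (4 * s ^ 2 - (m : ℂ) ^ 2)
      (fun u => y ((Real.sinh (2 * u) : ℂ) / (Real.cosh (2 * u) : ℂ)))
      (fun u => 2 / (Real.cosh (2 * u) : ℂ) ^ 2 *
        y₁ ((Real.sinh (2 * u) : ℂ) / (Real.cosh (2 * u) : ℂ))) := by
  intro u
  have hC := cosh_ofReal_ne_zero (2 * u)
  obtain ⟨h1, d, h2, h3⟩ := h _ (norm_sinh_div_cosh_lt (2 * u))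
  have hT := hasDerivAt_tanh_two_mul u
  refine ⟨(h1.scomp u hT).congr_deriv (by rw [smul_eq_mul]), ?_⟩
  have hC2 := (hasDerivAt_const u (2 : ℂ)).div ((hasDerivAt_cosh_two_mul u).pow 2)
    (pow_ne_zero 2 hC)
  refine (hC2.mul (h2.scomp u hT)).congr_deriv ?_
  have e : (1 - ((Real.sinh (2 * u) : ℂ) / (Real.cosh (2 * u) : ℂ)) ^ 2) =
      1 / (Real.cosh (2 * u) : ℂ) ^ 2 := by
    field_simp
    linear_combination cosh_sq_ofReal (2 * u)
  rw [e] at h3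
  simp only [Function.comp, smul_eq_mul, Pi.div_apply, Pi.pow_apply]
  set C := (Real.cosh (2 * u) : ℂ)
  set S := (Real.sinh (2 * u) : ℂ)
  have hd : d = C ^ 2 * ((2 * s + 1) * (S / C) * y₁ (S / C) + (s ^ 2 - (m : ℂ) ^ 2 / 4) * y (S / C)) := by
    rw [← h3]; field_simp
  rw [hd]
  simp
  field_simp
  ring

/-- Since |tanh| ≤ 1 and 1/cosh² ≤ 1, the associated first-order system is Lipschitz with one
constant for all u, so the initial data at 0 determine the solution globally. -/
theorem IsTanhSol.eq {κ lam : ℂ} {y z y' z' : ℝ → ℂ} (h : IsTanhSol κ lam y z)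
    (h' : IsTanhSol κ lam y' z') (h0 : y 0 = y' 0) (h1 : z 0 = z' 0) : y = y' := by
  set v : ℝ → ℂ × ℂ → ℂ × ℂ := fun u p =>
    (p.2, 2 * κ * ((Real.sinh (2 * u) : ℂ) / (Real.cosh (2 * u) : ℂ)) * p.2 +
      lam / (Real.cosh (2 * u) : ℂ) ^ 2 * p.1) with hv
  have hL : ∀ u, LipschitzOnWith (1 + 2 * ‖κ‖₊ + ‖lam‖₊) (v u) Set.univ := fun u => by
    refine LipschitzOnWith.of_dist_le_mul fun p _ q _ => ?_
    have hT := (norm_sinh_div_cosh_lt (2 * u)).le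
    have hC : ‖1 / (Real.cosh (2 * u) : ℂ) ^ 2‖ ≤ 1 := by
      rw [norm_div, norm_one, norm_pow, Complex.norm_real,
        Real.norm_of_nonneg (Real.cosh_pos _).le]
      have := Real.one_le_cosh (2 * u)
      exact div_le_one_of_le₀ (one_le_pow₀ this) (by positivity)
    have e1 : ‖p.1 - q.1‖ ≤ ‖p - q‖ := norm_fst_le (p - q)
    have e2 : ‖p.2 - q.2‖ ≤ ‖p - q‖ := norm_snd_le (p - q)
    rw [dist_eq_norm, dist_eq_norm, Prod.norm_def]
    push_cast
    refine max_le ?_ ?_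
    · have : (v u p - v u q).1 = p.2 - q.2 := rfl
      rw [this]
      nlinarith [norm_nonneg κ, norm_nonneg lam, norm_nonneg (p - q),
        mul_nonneg (norm_nonneg κ) (norm_nonneg (p - q)),
        mul_nonneg (norm_nonneg lam) (norm_nonneg (p - q))]
    · have : (v u p - v u q).2 =
          2 * κ * ((Real.sinh (2 * u) : ℂ) / (Real.cosh (2 * u) : ℂ)) * (p.2 - q.2) +
          lam * (1 / (Real.cosh (2 * u) : ℂ) ^ 2) * (p.1 - q.1) := by
        simp only [hv, Prod.snd_sub]; ring
      rw [this]
      calc _ ≤ 2 * ‖κ‖ * ‖(Real.sinh (2 * u) : ℂ) / (Real.cosh (2 * u) : ℂ)‖ * ‖p.2 - q.2‖ +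
            ‖lam‖ * ‖1 / (Real.cosh (2 * u) : ℂ) ^ 2‖ * ‖p.1 - q.1‖ := by
            refine (norm_add_le _ _).trans_eq ?_
            simp only [norm_mul, Complex.norm_ofNat]
        _ ≤ 2 * ‖κ‖ * 1 * ‖p - q‖ + ‖lam‖ * 1 * ‖p - q‖ := by gcongr
        _ ≤ _ := by
          nlinarith [norm_nonneg (p - q)]
  have key := ODE_solution_unique_univ (t₀ := 0) hL
    (f := fun u => (y u, z u)) (g := fun u => (y' u, z' u))
    (fun u => ⟨(h u).1.prodMk (h u).2, trivial⟩) (fun u => ⟨(h' u).1.prodMk (h' u).2, trivial⟩)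
    (by simp [h0, h1])
  funext u
  exact congrArg Prod.fst (congrFun key u)

/-! ### Jacobi functions through the even and odd solutions; holomorphy of c_m -/

theorem ofReal_sq_cpow {x : ℝ} (hx : 0 < x) (s : ℂ) : ((x : ℂ) ^ 2) ^ s = (x : ℂ) ^ (2 * s) := by
  rw [sq, Complex.mul_cpow_ofReal_nonneg hx.le hx.le, two_mul,
    Complex.cpow_add _ _ (by exact_mod_cast hx.ne')]

/-- Pfaff's transformation at x = -sinh² v, where 1 - x = cosh² v and x/(x-1) = tanh² v. -/
theorem jacobiFun_eq (α β ν : ℂ) (hα : ∀ n : ℕ, α + 1 + n ≠ 0) (v : ℝ) :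
    jacobiFun α β ν v = (Real.cosh v : ℂ) ^ (-(α + β + 1 + Complex.I * ν)) *
      ordinaryHypergeometric ((α + β + 1 + Complex.I * ν) / 2)
        ((α - β + 1 + Complex.I * ν) / 2) (α + 1)
        (((Real.sinh v : ℂ) / (Real.cosh v : ℂ)) ^ 2) := by
  have hC := cosh_ofReal_ne_zero v
  have hx : -(Real.sinh v) ^ 2 < 1 / 2 := by nlinarith [sq_nonneg (Real.sinh v)]
  rw [jacobiFun, hyp2F1_eq_pfaff _ _ hα hx, pfaff]
  have e1 : 1 - ((-(Real.sinh v) ^ 2 : ℝ) : ℂ) = (Real.cosh v : ℂ) ^ 2 := by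
    rw [cosh_sq_ofReal]; push_cast; ring
  have e2 : ((-(Real.sinh v) ^ 2 : ℝ) : ℂ) - 1 = -(Real.cosh v : ℂ) ^ 2 := by rw [← e1]; ring
  rw [e1, e2, ofReal_sq_cpow (Real.cosh_pos v)]
  congr 2
  · ring
  · ring
  · push_cast
    rw [neg_div_neg_eq, div_pow]

/-- The exponent from Pfaff's form is -(μ+1)/2 - m/2, and the factor cosh^(m/2) removes its
dependence on m. -/
theorem cosh_rpow_mul_phi (m : ℤ) (μ : ℂ) (v : ℝ) :
    ((Real.cosh v ^ ((m : ℝ) / 2) : ℝ) : ℂ) * phi m μ v = (Real.cosh v : ℂ) ^ (-((μ + 1) / 2)) *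
      evenSol m ((μ + 1) / 2) ((Real.sinh v : ℂ) / (Real.cosh v : ℂ)) := by
  have e : -1 / 2 + (m : ℂ) / 2 + 1 + Complex.I * (-Complex.I * μ / 2) = (μ + 1) / 2 + m / 2 := by
    linear_combination (-μ / 2) * Complex.I_sq
  have e' : -1 / 2 - (m : ℂ) / 2 + 1 + Complex.I * (-Complex.I * μ / 2) = (μ + 1) / 2 - m / 2 := by
    linear_combination (-μ / 2) * Complex.I_sq
  have h1 : (-1 / 2 : ℂ) + 1 = 1 / 2 := by norm_num
  rw [phi, jacobiFun_eq _ _ _ (by rw [h1]; exact half_add_nat_ne_zero),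
    Complex.ofReal_cpow (Real.cosh_pos v).le, e, e', h1, evenSol, ← mul_assoc,
    ← Complex.cpow_add _ _ (cosh_ofReal_ne_zero v)]
  congr 2
  push_cast; ring

/-- Here the exponent is lower by one than in the even case; the extra 1/cosh turns the factor sinh
of ψ into the factor tanh of `oddSol`. -/
theorem cosh_rpow_mul_psi (m : ℤ) (μ : ℂ) (v : ℝ) :
    ((Real.cosh v ^ ((m : ℝ) / 2) : ℝ) : ℂ) * psi m μ v =
      Complex.I * ((Real.cosh v : ℂ) ^ (-((μ + 1) / 2)) *
      oddSol m ((μ + 1) / 2) ((Real.sinh v : ℂ) / (Real.cosh v : ℂ))) := by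
  have hC := cosh_ofReal_ne_zero v
  have e : 1 / 2 + (m : ℂ) / 2 + 1 + Complex.I * (-Complex.I * μ / 2) =
      (μ + 1) / 2 + 1 + m / 2 := by
    linear_combination (-μ / 2) * Complex.I_sq
  have e' : 1 / 2 - (m : ℂ) / 2 + 1 + Complex.I * (-Complex.I * μ / 2) =
      (μ + 1) / 2 + 1 - m / 2 := by
    linear_combination (-μ / 2) * Complex.I_sq
  have h1 : (1 / 2 : ℂ) + 1 = 3 / 2 := by norm_num
  rw [psi, jacobiFun_eq _ _ _ (by rw [h1]; exact three_halves_add_nat_ne_zero),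
    Complex.ofReal_cpow (Real.cosh_pos v).le, e, e', h1, oddSol]
  have h2 : (Real.cosh v : ℂ) ^ (((m : ℝ) / 2 : ℝ) : ℂ) *
      (Real.cosh v : ℂ) ^ (-((μ + 1) / 2 + 1 + (m : ℂ) / 2)) =
      (Real.cosh v : ℂ) ^ (-((μ + 1) / 2)) / (Real.cosh v : ℂ) := by
    rw [← Complex.cpow_add _ _ hC, show (Real.cosh v : ℂ) ^ (-((μ + 1) / 2)) / (Real.cosh v : ℂ) =
      (Real.cosh v : ℂ) ^ (-((μ + 1) / 2) - 1) by rw [Complex.cpow_sub _ _ hC, Complex.cpow_one]]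
    congr 1
    push_cast; ring
  linear_combination (Complex.I * (Real.sinh v : ℂ) * ordinaryHypergeometric
    (((μ + 1) / 2 + 1 + m / 2) / 2) (((μ + 1) / 2 + 1 - m / 2) / 2) (3 / 2 : ℂ)
    (((Real.sinh v : ℂ) / (Real.cosh v : ℂ)) ^ 2)) * h2

theorem differentiable_cCoeff (m : ℤ) : Differentiable ℂ (cCoeff m) := by
  have h : Differentiable ℂ fun μ : ℂ => (2 : ℂ) ^ (1 - μ) * Real.pi *
      Complex.exp (Complex.I * m * Real.pi / 4) *
      ((Complex.Gamma ((μ + 3 + (|m| : ℤ)) / 4))⁻¹ * (Complex.Gamma ((μ + 3 - (|m| : ℤ)) / 4))⁻¹) := by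
    have h1 := Complex.differentiable_one_div_Gamma.comp
      (show Differentiable ℂ fun μ : ℂ => (μ + 3 + (|m| : ℤ)) / 4 by fun_prop)
    have h2 := Complex.differentiable_one_div_Gamma.comp
      (show Differentiable ℂ fun μ : ℂ => (μ + 3 - (|m| : ℤ)) / 4 by fun_prop)
    have h3 : Differentiable ℂ fun μ : ℂ => (2 : ℂ) ^ (1 - μ) := fun μ =>
      ((hasDerivAt_id μ).const_sub 1).const_cpow (Or.inl two_ne_zero) |>.differentiableAt
    exact ((h3.mul_const _).mul_const _).mul (h1.mul h2)
  convert h using 2 with μ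
  rw [cCoeff, div_eq_mul_inv, mul_inv]

/-! ### Calculus of signed powers -/

theorem signedPow_zero_right (δ : ZMod 2) {s : ℂ} (hs : s ≠ 0) : signedPow δ s 0 = 0 := by
  simp [signedPow, Complex.zero_cpow hs]

theorem signedPow_of_pos (δ : ZMod 2) (s : ℂ) {x : ℝ} (hx : 0 < x) :
    signedPow δ s x = (x : ℂ) ^ s := by
  simp [signedPow, sign_pos hx, abs_of_pos hx]

theorem signedPow_neg (δ : ZMod 2) (s : ℂ) (x : ℝ) :
    signedPow δ s (-x) = (-1) ^ δ.val * signedPow δ s x := by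
  rw [signedPow, signedPow, abs_neg, Left.sign_neg, ← mul_assoc, ← mul_pow]
  simp

theorem norm_signedPow_le (δ : ZMod 2) {s : ℂ} {x : ℝ} (hs : s.re ≠ 0) :
    ‖signedPow δ s x‖ ≤ |x| ^ s.re := by
  rw [signedPow, norm_mul, Complex.norm_cpow_eq_rpow_re_of_nonneg (abs_nonneg x) hs, norm_pow]
  refine mul_le_of_le_one_left (by positivity) (pow_le_one₀ (norm_nonneg _) ?_)
  rcases lt_trichotomy x 0 with h | h | h
  · simp [sign_neg h]
  · simp [h]
  · simp [sign_pos h]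

theorem val_add_one (δ : ZMod 2) : (δ = 0 ∧ (δ + 1).val = 1 ∧ δ.val = 0) ∨
    (δ = 1 ∧ (δ + 1).val = 0 ∧ δ.val = 1) := by
  revert δ; decide

/-- Since |x| = x sgn(x), lowering the exponent by one flips the parity. The case s = 0 fails at x =
0, where 0 to the power 0 is 1. -/
theorem signedPow_eq_mul (δ : ZMod 2) {s : ℂ} (hs : s ≠ 0) (x : ℝ) :
    signedPow δ s x = x * signedPow (δ + 1) (s - 1) x := by
  have pos : ∀ (δ : ZMod 2) {x : ℝ}, 0 < x →
      signedPow δ s x = x * signedPow (δ + 1) (s - 1) x := fun δ x hx => by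
    have hx' : (x : ℂ) ≠ 0 := by exact_mod_cast hx.ne'
    rw [signedPow_of_pos _ _ hx, signedPow_of_pos _ _ hx, Complex.cpow_sub _ _ hx',
      Complex.cpow_one]
    field_simp
  rcases lt_trichotomy x 0 with h | h | h
  · obtain ⟨y, hy, rfl⟩ : ∃ y : ℝ, 0 < y ∧ x = -y := ⟨-x, by linarith, by ring⟩
    rw [signedPow_neg, signedPow_neg, pos δ hy]
    rcases val_add_one δ with ⟨_, h1, h2⟩ | ⟨_, h1, h2⟩ <;> rw [h1, h2] <;> push_cast <;> ring
  · simp [h, signedPow_zero_right _ hs]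
  · exact pos δ h

/-- Away from 0 this is the power rule, with the odd reflection accounting for the change of parity.
At 0 the difference quotient is at most |x|^(Re s - 1), which tends to 0 because Re s > 1. -/
theorem hasDerivAt_signedPow (δ : ZMod 2) {s : ℂ} (hs : 1 < s.re) (x : ℝ) :
    HasDerivAt (signedPow δ s) (s * signedPow (δ + 1) (s - 1) x) x := by
  have hs0 : s ≠ 0 := fun h => by simp [h] at hs; linarith
  have hs1 : s - 1 ≠ 0 := fun h => by
    have := congrArg Complex.re h
    simp at this
    linarith
  have pos : ∀ (δ : ZMod 2) {x : ℝ}, 0 < x →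
      HasDerivAt (signedPow δ s) (s * signedPow (δ + 1) (s - 1) x) x := fun δ x hx => by
    have h1 : HasDerivAt (fun y : ℝ => (y : ℂ) ^ s) (s * (x : ℂ) ^ (s - 1)) x := by
      have := ((hasDerivAt_id (x : ℂ)).cpow_const (c := s) (Or.inl (by simpa using hx))).comp_ofReal
      simpa using this
    rw [signedPow_of_pos _ _ hx]
    refine h1.congr_of_eventuallyEq ?_
    filter_upwards [Ioi_mem_nhds hx] with y hy using signedPow_of_pos _ _ hy
  rcases lt_trichotomy x 0 with h | h | h
  · obtain ⟨y, hy, rfl⟩ : ∃ y : ℝ, 0 < y ∧ x = -y := ⟨-x, by linarith, by ring⟩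
    have h1 : HasDerivAt (fun x => (-1) ^ δ.val * signedPow δ s (-x))
        (s * signedPow (δ + 1) (s - 1) (-y)) (-y) := by
      have h2 := (pos δ hy)
      rw [← neg_neg y] at h2
      refine ((h2.scomp (-y) (hasDerivAt_neg (-y))).const_mul ((-1) ^ δ.val)).congr_deriv ?_
      rw [signedPow_neg _ _ y, neg_neg]
      rcases val_add_one δ with ⟨_, h1, h2⟩ | ⟨_, h1, h2⟩ <;> rw [h1, h2] <;> simp
    refine h1.congr_of_eventuallyEq ?_
    filter_upwards [Iio_mem_nhds h] with z _
    rw [signedPow_neg, ← mul_assoc, ← mul_pow]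
    simp
  · subst h
    rw [signedPow_zero_right _ hs1, mul_zero, hasDerivAt_iff_isLittleO]
    simp only [signedPow_zero_right _ hs0, sub_zero, smul_zero]
    refine Asymptotics.IsBigO.trans_isLittleO (g := fun x : ℝ => |x| ^ s.re)
      (Asymptotics.isBigO_of_le _ fun x => ?_) ?_
    · rw [Real.norm_of_nonneg (by positivity)]
      exact norm_signedPow_le δ (by linarith)
    · rw [Asymptotics.isLittleO_iff_tendsto' (by
        filter_upwards with x hx; simp [hx, Real.zero_rpow (show s.re ≠ 0 by linarith)])]
      have h1 : Tendsto (fun x : ℝ => |x| ^ (s.re - 1)) (𝓝 0) (𝓝 0) := by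
        have : ContinuousAt (fun x : ℝ => |x| ^ (s.re - 1)) 0 :=
          continuous_abs.continuousAt.rpow_const (Or.inr (by linarith))
        simpa [ContinuousAt, Real.zero_rpow (show s.re - 1 ≠ 0 by linarith)] using this
      rw [tendsto_zero_iff_norm_tendsto_zero]
      refine h1.congr fun x => ?_
      rcases eq_or_ne x 0 with rfl | hx
      · simp [Real.zero_rpow (show s.re - 1 ≠ 0 by linarith)]
      · rw [norm_div, Real.norm_of_nonneg (by positivity), Real.norm_eq_abs, Real.rpow_sub_one]
        simpa using hx
  · exact pos δ h

theorem continuous_signedPow (δ : ZMod 2) {s : ℂ} (hs : 1 < s.re) : Continuous (signedPow δ s) :=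
  continuous_iff_continuousAt.2 fun x => (hasDerivAt_signedPow δ hs x).continuousAt

/-! ### The angular kernel: derivatives and recurrence -/

/-- The upper left entry of `b_{-u} k_α`. -/
noncomputable def entryA (u α : ℝ) : ℝ := Real.cosh u * Real.cos α + -Real.sinh u * -Real.sin α

/-- The lower left entry of `b_{-u} k_α`. -/
noncomputable def entryB (u α : ℝ) : ℝ := -Real.sinh u * Real.cos α + Real.cosh u * -Real.sin α

/-- The kernel at `b_{-u} k_α`, with independent parities. -/
noncomputable def angKernel (δ δ' : ZMod 2) (σ : ℂ) (u α : ℝ) : ℂ :=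
  signedPow δ σ (entryA u α) * signedPow δ' σ (entryB u α)

theorem hasDerivAt_entryA_left (u α : ℝ) :
    HasDerivAt (fun u => entryA u α) (-entryB u α) u := by
  refine (((Real.hasDerivAt_cosh u).mul_const _).add
    ((Real.hasDerivAt_sinh u).neg.mul_const _)).congr_deriv ?_
  rw [entryB]; ring

theorem hasDerivAt_entryB_left (u α : ℝ) :
    HasDerivAt (fun u => entryB u α) (-entryA u α) u := by
  refine (((Real.hasDerivAt_sinh u).neg.mul_const _).add
    ((Real.hasDerivAt_cosh u).mul_const _)).congr_deriv ?_
  rw [entryA]; ring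

theorem hasDerivAt_entryA_right (u α : ℝ) :
    HasDerivAt (entryA u) (-Real.cosh u * Real.sin α + Real.sinh u * Real.cos α) α := by
  refine (((Real.hasDerivAt_cos α).const_mul _).add
    ((Real.hasDerivAt_sin α).neg.const_mul _)).congr_deriv ?_
  ring

theorem hasDerivAt_entryB_right (u α : ℝ) :
    HasDerivAt (entryB u) (Real.sinh u * Real.sin α - Real.cosh u * Real.cos α) α := by
  refine (((Real.hasDerivAt_cos α).const_mul _).add
    ((Real.hasDerivAt_sin α).neg.const_mul _)).congr_deriv ?_
  ring

theorem entryA_mul_entryB (u α : ℝ) : 2 * (entryA u α * entryB u α) =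
    -(Real.sinh (2 * u) + Real.cosh (2 * u) * Real.sin (2 * α)) := by
  rw [entryA, entryB, Real.sinh_two_mul, Real.cosh_two_mul, Real.sin_two_mul]
  linear_combination (-2 * Real.cosh u * Real.sinh u) * Real.sin_sq_add_cos_sq α

theorem entryA_sq_add_entryB_sq (u α : ℝ) : entryA u α ^ 2 + entryB u α ^ 2 =
    Real.cosh (2 * u) + Real.sinh (2 * u) * Real.sin (2 * α) := by
  rw [entryA, entryB, Real.sinh_two_mul, Real.cosh_two_mul, Real.sin_two_mul]
  linear_combination (Real.cosh u ^ 2 + Real.sinh u ^ 2) * Real.sin_sq_add_cos_sq α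

theorem angKernel_eq_mul (δ δ' : ZMod 2) {σ : ℂ} (hσ : σ ≠ 0) (u α : ℝ) :
    angKernel δ δ' σ u α =
      (entryA u α * entryB u α : ℝ) * angKernel (δ + 1) (δ' + 1) (σ - 1) u α := by
  rw [angKernel, angKernel, signedPow_eq_mul δ hσ, signedPow_eq_mul δ' hσ]
  push_cast; ring

theorem angKernel_eq_sq_mul (δ δ' : ZMod 2) {σ : ℂ} (hσ : 1 < σ.re) (u α : ℝ) :
    angKernel (δ + 1) (δ' + 1) (σ - 1) u α =
      (entryA u α * entryB u α : ℝ) * angKernel δ δ' (σ - 2) u α := by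
  rw [angKernel_eq_mul (δ + 1) (δ' + 1) fun h => ?_]
  · have h2 : (1 : ZMod 2) + 1 = 0 := by decide
    rw [add_assoc, add_assoc, h2, add_zero, add_zero, show σ - 1 - 1 = σ - 2 by ring]
  · have := congrArg Complex.re h
    simp at this
    linarith

/-- The product rule yields -σ(A² + B²) times the kernel at level σ-1, and A² + B² = 1/cosh 2u - 2
tanh(2u) AB. The factor AB raises the level back to σ. -/
theorem hasDerivAt_angKernel_left (δ δ' : ZMod 2) {σ : ℂ} (hσ : 1 < σ.re) (u α : ℝ) :
    HasDerivAt (fun u => angKernel δ δ' σ u α)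
      (-σ / (Real.cosh (2 * u) : ℂ) * angKernel (δ + 1) (δ' + 1) (σ - 1) u α +
        2 * σ * ((Real.sinh (2 * u) : ℂ) / (Real.cosh (2 * u) : ℂ)) * angKernel δ δ' σ u α) u := by
  have hσ0 : σ ≠ 0 := fun h => by simp [h] at hσ; linarith
  have hC := cosh_ofReal_ne_zero (2 * u)
  have h1 := (hasDerivAt_signedPow δ hσ _).scomp u (hasDerivAt_entryA_left u α)
  have h2 := (hasDerivAt_signedPow δ' hσ _).scomp u (hasDerivAt_entryB_left u α)
  refine (h1.mul h2).congr_deriv ?_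
  rw [angKernel_eq_mul δ δ' hσ0]
  simp only [Function.comp, Complex.real_smul, angKernel]
  rw [signedPow_eq_mul δ hσ0, signedPow_eq_mul δ' hσ0]
  have e1 : 2 * ((entryA u α : ℂ) * entryB u α) =
    -(Real.sinh (2 * u) + Real.cosh (2 * u) * Real.sin (2 * α)) := by
    exact_mod_cast entryA_mul_entryB u α
  have e2 : (entryA u α : ℂ) ^ 2 + (entryB u α : ℂ) ^ 2 =
    Real.cosh (2 * u) + Real.sinh (2 * u) * Real.sin (2 * α) := by
    exact_mod_cast entryA_sq_add_entryB_sq u α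
  have e3 := cosh_sq_ofReal (2 * u)
  have e4 : (entryA u α : ℂ) ^ 2 + (entryB u α : ℂ) ^ 2 = 1 / (Real.cosh (2 * u) : ℂ)
      - 2 * ((Real.sinh (2 * u) : ℂ) / (Real.cosh (2 * u) : ℂ)) * (entryA u α * entryB u α) := by
    field_simp
    linear_combination (Real.cosh (2 * u) : ℂ) * e2 + (Real.sinh (2 * u) : ℂ) * e1 + e3
  simp only [Complex.ofReal_mul, Complex.ofReal_neg]
  set P := signedPow (δ + 1) (σ - 1) (entryA u α)
  set P' := signedPow (δ' + 1) (σ - 1) (entryB u α)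
  linear_combination (-σ * P * P') * e4

theorem hasDerivAt_angKernel_right (δ δ' : ZMod 2) {σ : ℂ} (hσ : 1 < σ.re) (u α : ℝ) :
    HasDerivAt (angKernel δ δ' σ u)
      (-σ * (Real.cosh (2 * u) : ℂ) * (Real.cos (2 * α) : ℂ) *
        angKernel (δ + 1) (δ' + 1) (σ - 1) u α) α := by
  have hσ0 : σ ≠ 0 := fun h => by simp [h] at hσ; linarith
  have h1 := (hasDerivAt_signedPow δ hσ _).scomp α (hasDerivAt_entryA_right u α)
  have h2 := (hasDerivAt_signedPow δ' hσ _).scomp α (hasDerivAt_entryB_right u α)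
  refine (h1.mul h2).congr_deriv ?_
  simp only [Function.comp, Complex.real_smul, angKernel]
  rw [signedPow_eq_mul δ hσ0, signedPow_eq_mul δ' hσ0]
  have e : (-Real.cosh u * Real.sin α + Real.sinh u * Real.cos α) * entryB u α +
      entryA u α * (Real.sinh u * Real.sin α - Real.cosh u * Real.cos α) =
      -(Real.cosh (2 * u) * Real.cos (2 * α)) := by
    rw [entryA, entryB, Real.cosh_two_mul, Real.cos_two_mul']
    ring
  have e' := congrArg (fun x : ℝ => (x : ℂ)) e
  simp only [Complex.ofReal_add, Complex.ofReal_mul, Complex.ofReal_neg, Complex.ofReal_sub] at e' ⊢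
  set P := signedPow (δ + 1) (σ - 1) (entryA u α)
  set P' := signedPow (δ' + 1) (σ - 1) (entryB u α)
  linear_combination (σ * P * P') * e'

theorem continuous_angKernel (δ δ' : ZMod 2) {σ : ℂ} (hσ : 1 < σ.re) :
    Continuous fun p : ℝ × ℝ => angKernel δ δ' σ p.1 p.2 := by
  have hA : Continuous fun p : ℝ × ℝ => entryA p.1 p.2 := by unfold entryA; fun_prop
  have hB : Continuous fun p : ℝ × ℝ => entryB p.1 p.2 := by unfold entryB; fun_prop
  exact ((continuous_signedPow δ hσ).comp hA).mul ((continuous_signedPow δ' hσ).comp hB)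

/-- The Poisson integral of `k_θ ↦ e^{imθ}` at `b_u`, with independent parities. -/
noncomputable def angIntegral (δ δ' : ZMod 2) (m : ℤ) (σ : ℂ) (u : ℝ) : ℂ :=
  ∫ α in (0 : ℝ)..(2 * Real.pi), angKernel δ δ' σ u α * Complex.exp (Complex.I * m * α)

/-- On the compact set [u-1, u+1] × [a, b] the derivative is bounded, which provides the dominating
constant. -/
theorem hasDerivAt_integral_of_continuous {F F' : ℝ → ℝ → ℂ}
    (hF : Continuous fun p : ℝ × ℝ => F p.1 p.2) (hF' : Continuous fun p : ℝ × ℝ => F' p.1 p.2)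
    (h : ∀ u α, HasDerivAt (fun u => F u α) (F' u α) u) (a b u : ℝ) :
    HasDerivAt (fun u => ∫ α in a..b, F u α) (∫ α in a..b, F' u α) u := by
  obtain ⟨C, hC⟩ := ((isCompact_Icc (a := u - 1) (b := u + 1)).prod
    (isCompact_uIcc (a := a) (b := b))).exists_bound_of_continuousOn hF'.continuousOn
  have hFu : ∀ u, Continuous (F u) := fun u => hF.comp (Continuous.prodMk_right u)
  have hFu' : ∀ u, Continuous (F' u) := fun u => hF'.comp (Continuous.prodMk_right u)
  refine (intervalIntegral.hasDerivAt_integral_of_dominated_loc_of_deriv_le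
    (bound := fun _ => C) (Icc_mem_nhds (show u - 1 < u by linarith) (show u < u + 1 by linarith))
    (Eventually.of_forall fun v => (hFu v).aestronglyMeasurable)
    ((hFu u).intervalIntegrable _ _) (hFu' u).aestronglyMeasurable
    (Eventually.of_forall fun α hα v hv => hC (v, α) ⟨hv, Set.uIoc_subset_uIcc hα⟩)
    intervalIntegrable_const (Eventually.of_forall fun α _ v _ => h v α)).2

theorem hasDerivAt_angIntegral (δ δ' : ZMod 2) (m : ℤ) {σ : ℂ} (hσ : 2 < σ.re) (u : ℝ) :
    HasDerivAt (angIntegral δ δ' m σ)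
      (-σ / (Real.cosh (2 * u) : ℂ) * angIntegral (δ + 1) (δ' + 1) m (σ - 1) u +
        2 * σ * ((Real.sinh (2 * u) : ℂ) / (Real.cosh (2 * u) : ℂ)) * angIntegral δ δ' m σ u) u := by
  have hσ1 : 1 < σ.re := by linarith
  have hσ2 : 1 < (σ - 1).re := by simp; linarith
  have c1 := continuous_angKernel δ δ' hσ1
  have c2 := continuous_angKernel (δ + 1) (δ' + 1) hσ2
  have hexp : Continuous fun p : ℝ × ℝ => Complex.exp (Complex.I * m * p.2) := by fun_prop
  have hC : Continuous fun p : ℝ × ℝ => (Real.cosh (2 * p.1) : ℂ) := by fun_prop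
  have hS : Continuous fun p : ℝ × ℝ => (Real.sinh (2 * p.1) : ℂ) := by fun_prop
  have hC0 : ∀ p : ℝ × ℝ, (Real.cosh (2 * p.1) : ℂ) ≠ 0 := fun p => cosh_ofReal_ne_zero _
  refine (hasDerivAt_integral_of_continuous (c1.mul hexp)
    ((((continuous_const (y := -σ)).div hC hC0).mul c2).add
      (((continuous_const (y := 2 * σ)).mul (hS.div hC hC0)).mul c1) |>.mul hexp)
    (fun u α => (hasDerivAt_angKernel_left δ δ' hσ1 u α).mul_const _) _ _ u).congr_deriv ?_
  have i1 : ∀ {δ δ' : ZMod 2} {σ : ℂ}, 1 < σ.re → IntervalIntegrable (fun α : ℝ =>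
      angKernel δ δ' σ u α * Complex.exp (Complex.I * m * α)) volume 0 (2 * Real.pi) :=
    fun h => (((continuous_angKernel _ _ h).mul hexp).comp
      (Continuous.prodMk_right u)).intervalIntegrable _ _
  rw [angIntegral, angIntegral, ← intervalIntegral.integral_const_mul,
    ← intervalIntegral.integral_const_mul, ← intervalIntegral.integral_add
      ((i1 hσ2).const_mul _) ((i1 hσ1).const_mul _)]
  congr 1
  funext α
  ring

theorem entryA_add_two_pi (u α : ℝ) : entryA u (α + 2 * Real.pi) = entryA u α := by
  simp [entryA]

theorem entryB_add_two_pi (u α : ℝ) : entryB u (α + 2 * Real.pi) = entryB u α := by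
  simp [entryB]

theorem exp_add_two_pi (m : ℤ) (α : ℝ) : Complex.exp (Complex.I * m * (α + 2 * Real.pi : ℝ)) =
    Complex.exp (Complex.I * m * α) := by
  rw [← Complex.exp_periodic.int_mul m (Complex.I * m * α)]
  congr 1
  push_cast; ring

/-- Integration by parts relates the integrals for `σ`, `σ - 1` and `σ - 2`. -/
theorem angIntegral_recurrence (δ δ' : ZMod 2) (m : ℤ) {σ : ℂ} (hσ : 3 < σ.re) (u : ℝ) :
    (4 * σ ^ 2 - (m : ℂ) ^ 2) * angIntegral δ δ' m σ u +
      2 * σ * (2 * σ - 1) * (Real.sinh (2 * u) : ℂ) *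
        angIntegral (δ + 1) (δ' + 1) m (σ - 1) u -
      σ * (σ - 1) * angIntegral δ δ' m (σ - 2) u = 0 := by
  have hσ1 : 1 < σ.re := by linarith
  have hσ2 : 1 < (σ - 1).re := by simp; linarith
  have hσ3 : 1 < (σ - 2).re := by simp; linarith
  have hσ0 : σ ≠ 0 := fun h => by simp [h] at hσ; linarith
  have hexp : Continuous fun p : ℝ × ℝ => Complex.exp (Complex.I * m * p.2) := by fun_prop
  have i1 : ∀ {δ δ' : ZMod 2} {σ : ℂ}, 1 < σ.re → IntervalIntegrable (fun α : ℝ =>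
      angKernel δ δ' σ u α * Complex.exp (Complex.I * m * α)) volume 0 (2 * Real.pi) :=
    fun h => (((continuous_angKernel _ _ h).mul hexp).comp
      (Continuous.prodMk_right u)).intervalIntegrable _ _
  set C := (Real.cosh (2 * u) : ℂ) with hC
  set S := (Real.sinh (2 * u) : ℂ) with hS
  have h2 : (1 : ZMod 2) + 1 = 0 := by decide
  -- With K the kernel, the differentiated function is (∂K - imK) e^{imα}, so its derivative is (∂²K
  -- + m²K) e^{imα}. Expressing ∂²K through the levels σ, σ-1, σ-2 uses (cosh 2u cos 2α)² = 1 - 4Q²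
  -- - 4Q sinh 2u with Q = AB. The boundary terms cancel by periodicity.
  have hd : ∀ α : ℝ, HasDerivAt (fun α : ℝ => (-σ * C * ((Real.cos (2 * α) : ℂ) *
      angKernel (δ + 1) (δ' + 1) (σ - 1) u α) - Complex.I * m * angKernel δ δ' σ u α) *
      Complex.exp (Complex.I * m * α))
      (-(4 * σ ^ 2 - (m : ℂ) ^ 2) * (angKernel δ δ' σ u α * Complex.exp (Complex.I * m * α)) +
        -(2 * σ * (2 * σ - 1) * S) *
        (angKernel (δ + 1) (δ' + 1) (σ - 1) u α * Complex.exp (Complex.I * m * α)) +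
        σ * (σ - 1) * (angKernel δ δ' (σ - 2) u α * Complex.exp (Complex.I * m * α))) α := by
    intro α
    have k1 := hasDerivAt_angKernel_right δ δ' hσ1 u α
    have k2 := hasDerivAt_angKernel_right (δ + 1) (δ' + 1) hσ2 u α
    rw [add_assoc, add_assoc, h2, add_zero, add_zero, show σ - 1 - 1 = σ - 2 by ring] at k2
    have k3 : HasDerivAt (fun α : ℝ => (Real.cos (2 * α) : ℂ)) (-2 * (Real.sin (2 * α) : ℂ)) α := by
      refine (((hasDerivAt_id α).const_mul 2).cos).ofReal_comp.congr_deriv ?_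
      simp; ring
    have k4 : HasDerivAt (fun α : ℝ => Complex.exp (Complex.I * m * α))
        (Complex.exp (Complex.I * m * α) * (Complex.I * m)) α := by
      refine (((hasDerivAt_id (α : ℂ)).const_mul (Complex.I * m)).cexp).comp_ofReal.congr_deriv ?_
      simp
    refine ((((k3.mul k2).const_mul (-σ * C)).sub (k1.const_mul (Complex.I * m))).mul
      k4).congr_deriv ?_
    have e1 : 2 * ((entryA u α * entryB u α : ℝ) : ℂ) = -(S + C * (Real.sin (2 * α) : ℂ)) := by
      rw [hC, hS]
      exact_mod_cast entryA_mul_entryB u α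
    have e2 : (Real.cos (2 * α) : ℂ) ^ 2 = 1 - (Real.sin (2 * α) : ℂ) ^ 2 := by
      exact_mod_cast Real.cos_sq' (2 * α)
    have e3 : C ^ 2 = S ^ 2 + 1 := cosh_sq_ofReal (2 * u)
    have a1 := angKernel_eq_mul δ δ' hσ0 u α
    have a2 := angKernel_eq_sq_mul δ δ' hσ1 u α
    simp only [Pi.mul_apply, Pi.sub_apply]
    rw [a1, a2]
    set Q := ((entryA u α * entryB u α : ℝ) : ℂ)
    set K := angKernel δ δ' (σ - 2) u α
    set E := Complex.exp (Complex.I * m * α)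
    set s := (Real.sin (2 * α) : ℂ)
    set c := (Real.cos (2 * α) : ℂ)
    have hs : C * s = -(S + 2 * Q) := by linear_combination e1
    have hc : (C * c) ^ 2 = 1 - 4 * Q ^ 2 - 4 * Q * S := by
      linear_combination C ^ 2 * e2 + e3 - (C * s - (S + 2 * Q)) * hs
    linear_combination (2 * σ * Q * K * E) * hs + (σ * (σ - 1) * K * E) * hc -
      (m ^ 2 * Q ^ 2 * K * E) * Complex.I_sq
  have hint := intervalIntegral.integral_eq_sub_of_hasDerivAt (a := 0) (b := 2 * Real.pi)
    (fun α _ => hd α) ((((i1 hσ1).const_mul _).add ((i1 hσ2).const_mul _)).add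
      ((i1 hσ3).const_mul _))
  rw [intervalIntegral.integral_add (((i1 hσ1).const_mul _).add ((i1 hσ2).const_mul _))
      ((i1 hσ3).const_mul _), intervalIntegral.integral_add ((i1 hσ1).const_mul _)
      ((i1 hσ2).const_mul _), intervalIntegral.integral_const_mul,
    intervalIntegral.integral_const_mul, intervalIntegral.integral_const_mul] at hint
  have p1 : Complex.exp (Complex.I * m * (2 * Real.pi : ℝ)) =
      Complex.exp (Complex.I * m * (0 : ℝ)) := by
    simpa using exp_add_two_pi m 0
  have p2 : ∀ δ δ' σ, angKernel δ δ' σ u (2 * Real.pi) = angKernel δ δ' σ u 0 := fun δ δ' σ => by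
    rw [angKernel, angKernel, ← zero_add (2 * Real.pi), entryA_add_two_pi, entryB_add_two_pi]
  have p3 : Real.cos (2 * (2 * Real.pi)) = Real.cos (2 * 0) := by
    rw [mul_zero, Real.cos_zero]
    exact_mod_cast Real.cos_nat_mul_two_pi 2
  rw [p1, p2, p2, p3, sub_self] at hint
  simp only [angIntegral]
  linear_combination -hint

/-! ### Moments over a quarter circle -/

/-- `∫₀^{π/2} (cos α sin α)^σ e^{imα} dα`. -/
noncomputable def trigMoment (m : ℤ) (σ : ℂ) : ℂ :=
  ∫ α in (0 : ℝ)..(Real.pi / 2),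
    ((Real.cos α * Real.sin α : ℝ) : ℂ) ^ σ * Complex.exp (Complex.I * m * α)

theorem continuous_trigMoment_integrand (m : ℤ) {σ : ℂ} (hσ : 0 < σ.re) : Continuous fun α : ℝ =>
    ((Real.cos α * Real.sin α : ℝ) : ℂ) ^ σ * Complex.exp (Complex.I * m * α) := by
  have h1 := (Complex.continuous_ofReal_cpow_const hσ).comp
    (Real.continuous_cos.mul Real.continuous_sin)
  exact h1.mul (by fun_prop)

theorem signedPow_of_nonneg (δ : ZMod 2) {s : ℂ} (hs : s ≠ 0) {x : ℝ} (hx : 0 ≤ x) :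
    signedPow δ s x = (x : ℂ) ^ s := by
  rcases hx.eq_or_lt with rfl | h
  · simp [signedPow_zero_right _ hs, Complex.zero_cpow hs]
  · exact signedPow_of_pos _ _ h

theorem cos_nonneg_of_mem_uIcc {α : ℝ} (h : α ∈ Set.uIcc 0 (Real.pi / 2)) : 0 ≤ Real.cos α := by
  rw [Set.uIcc_of_le (by positivity)] at h
  exact Real.cos_nonneg_of_mem_Icc ⟨by linarith [h.1, Real.pi_pos], h.2⟩

theorem sin_nonneg_of_mem_uIcc {α : ℝ} (h : α ∈ Set.uIcc 0 (Real.pi / 2)) : 0 ≤ Real.sin α := by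
  rw [Set.uIcc_of_le (by positivity)] at h
  exact Real.sin_nonneg_of_nonneg_of_le_pi h.1 (by linarith [h.2, Real.pi_pos])

/-- The reflection α ↦ π/2 - α exchanges cosine and sine. -/
theorem trigMoment_neg (m : ℤ) (σ : ℂ) :
    trigMoment m σ = Complex.exp (Complex.I * m * (Real.pi / 2)) * trigMoment (-m) σ := by
  rw [trigMoment, trigMoment, ← intervalIntegral.integral_const_mul]
  have := intervalIntegral.integral_comp_sub_left (a := 0) (b := Real.pi / 2) (fun α : ℝ =>
    ((Real.cos α * Real.sin α : ℝ) : ℂ) ^ σ * Complex.exp (Complex.I * m * α)) (Real.pi / 2)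
  rw [sub_self, sub_zero] at this
  rw [← this]
  congr 1
  funext α
  rw [Real.cos_pi_div_two_sub, Real.sin_pi_div_two_sub, mul_comm (Real.sin α), mul_left_comm,
    ← Complex.exp_add]
  congr 2
  push_cast; ring

/-- The function (cos α sin α)^(σ+1) e^{imα} vanishes at both endpoints; its derivative, written
with e^{±2iα}, is a combination of the integrands for m+2 and m-2. -/
theorem trigMoment_step (m : ℤ) {σ : ℂ} (hσ : 0 < σ.re) :
    (2 * (σ + 1) + m) * trigMoment (m + 2) σ + (2 * (σ + 1) - m) * trigMoment (m - 2) σ = 0 := by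
  have hσ0 : σ ≠ 0 := fun h => by simp [h] at hσ
  have hσ1 : σ + 1 ≠ 0 := fun h => by
    have := congrArg Complex.re h
    simp at this
    linarith
  have hre : 1 < (σ + 1).re := by simpa using hσ
  have hd : ∀ α ∈ Set.uIcc 0 (Real.pi / 2), HasDerivAt (fun α : ℝ =>
      signedPow 0 (σ + 1) (Real.cos α * Real.sin α) * Complex.exp (Complex.I * m * α))
      ((2 * (σ + 1) + m) / 4 * (((Real.cos α * Real.sin α : ℝ) : ℂ) ^ σ *
        Complex.exp (Complex.I * (m + 2 : ℤ) * α)) + (2 * (σ + 1) - m) / 4 *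
        (((Real.cos α * Real.sin α : ℝ) : ℂ) ^ σ *
        Complex.exp (Complex.I * (m - 2 : ℤ) * α))) α := by
    intro α hα
    have hx := mul_nonneg (cos_nonneg_of_mem_uIcc hα) (sin_nonneg_of_mem_uIcc hα)
    have k1 := (hasDerivAt_signedPow 0 hre (Real.cos α * Real.sin α)).scomp α
      ((Real.hasDerivAt_cos α).mul (Real.hasDerivAt_sin α))
    have k4 : HasDerivAt (fun α : ℝ => Complex.exp (Complex.I * m * α))
        (Complex.exp (Complex.I * m * α) * (Complex.I * m)) α := by
      refine (((hasDerivAt_id (α : ℂ)).const_mul (Complex.I * m)).cexp).comp_ofReal.congr_deriv ?_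
      simp
    refine (k1.mul k4).congr_deriv ?_
    simp only [Function.comp, Complex.real_smul, Pi.mul_apply]
    rw [signedPow_eq_mul 0 hσ1, add_sub_cancel_right, signedPow_of_nonneg _ hσ0 hx]
    have e1 : Complex.exp (Complex.I * (m + 2 : ℤ) * α) =
        Complex.exp (Complex.I * m * α) * (Complex.cos α + Complex.sin α * Complex.I) ^ 2 := by
      rw [← Complex.exp_mul_I, ← Complex.exp_nat_mul, ← Complex.exp_add]
      congr 1
      push_cast; ring
    have e2 : Complex.exp (Complex.I * (m - 2 : ℤ) * α) =
        Complex.exp (Complex.I * m * α) * (Complex.cos α - Complex.sin α * Complex.I) ^ 2 := by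
      have : Complex.cos α - Complex.sin α * Complex.I = Complex.exp (-α * Complex.I) := by
        rw [Complex.exp_mul_I, Complex.cos_neg, Complex.sin_neg]; ring
      rw [this, ← Complex.exp_nat_mul, ← Complex.exp_add]
      congr 1
      push_cast; ring
    rw [e1, e2]
    simp only [Complex.ofReal_mul, Complex.ofReal_add, Complex.ofReal_neg, Complex.ofReal_cos,
      Complex.ofReal_sin]
    set E := Complex.exp (Complex.I * m * α)
    set c := Complex.cos α
    set s := Complex.sin α
    set K := (c * s) ^ σ
    linear_combination (-(σ + 1) * K * E * s ^ 2) * Complex.I_sq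
  have i1 : ∀ m : ℤ, IntervalIntegrable (fun α : ℝ => ((Real.cos α * Real.sin α : ℝ) : ℂ) ^ σ *
      Complex.exp (Complex.I * m * α)) volume 0 (Real.pi / 2) := fun m =>
    (continuous_trigMoment_integrand m hσ).intervalIntegrable _ _
  have hint := intervalIntegral.integral_eq_sub_of_hasDerivAt hd
    (((i1 (m + 2)).const_mul _).add ((i1 (m - 2)).const_mul _))
  rw [intervalIntegral.integral_add ((i1 (m + 2)).const_mul _) ((i1 (m - 2)).const_mul _),
    intervalIntegral.integral_const_mul, intervalIntegral.integral_const_mul] at hint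
  simp only [Real.cos_pi_div_two, Real.sin_zero, zero_mul, mul_zero,
    signedPow_zero_right _ hσ1, sub_zero] at hint
  simp only [trigMoment]
  linear_combination 4 * hint

/-- The substitution x = sin² α gives half a beta integral. The bounds on the real parts make the
substituted integrand continuous up to the endpoints. -/
theorem integral_cos_cpow_mul_sin_cpow {a b : ℂ} (ha : 1 < a.re) (hb : 1 < b.re) :
    ∫ α in (0 : ℝ)..(Real.pi / 2), (Real.cos α : ℂ) ^ a * (Real.sin α : ℂ) ^ b =
      Complex.Gamma ((a + 1) / 2) * Complex.Gamma ((b + 1) / 2) /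
        (2 * Complex.Gamma ((a + b + 2) / 2)) := by
  have hga : 0 < ((a + 1) / 2).re := by simp; linarith
  have hgb : 0 < ((b + 1) / 2).re := by simp; linarith
  have hgab : 0 < ((a + b + 2) / 2).re := by simp; linarith
  have hβ := Complex.Gamma_mul_Gamma_eq_betaIntegral hgb hga
  rw [show (b + 1) / 2 + (a + 1) / 2 = (a + b + 2) / 2 by ring] at hβ
  have hG : Complex.Gamma ((a + b + 2) / 2) ≠ 0 := Complex.Gamma_ne_zero_of_re_pos hgab
  have h1 : 0 < ((b + 1) / 2 - 1).re := by simp; linarith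
  have h2 : 0 < ((a + 1) / 2 - 1).re := by simp; linarith
  have hg : Continuous fun x : ℝ =>
      (x : ℂ) ^ ((b + 1) / 2 - 1) * ((1 - x : ℝ) : ℂ) ^ ((a + 1) / 2 - 1) :=
    (Complex.continuous_ofReal_cpow_const h1).mul
      ((Complex.continuous_ofReal_cpow_const h2).comp (continuous_const.sub continuous_id))
  have hs := intervalIntegral.integral_deriv_smul_comp (a := 0) (b := Real.pi / 2)
    (f := fun α => Real.sin α ^ 2) (f' := fun α => 2 * Real.sin α * Real.cos α)
    (fun α _ => ((Real.hasDerivAt_sin α).pow 2).congr_deriv (by simp)) (by fun_prop) hg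
  have hB : Complex.betaIntegral ((b + 1) / 2) ((a + 1) / 2) =
      ∫ x in (0 : ℝ)..1, (x : ℂ) ^ ((b + 1) / 2 - 1) * ((1 - x : ℝ) : ℂ) ^ ((a + 1) / 2 - 1) := by
    rw [Complex.betaIntegral]; push_cast; rfl
  simp only [Real.sin_zero, Real.sin_pi_div_two, one_pow, ne_eq, OfNat.ofNat_ne_zero,
    not_false_eq_true, zero_pow] at hs
  rw [← hB] at hs
  have hI : ∫ α in (0 : ℝ)..(Real.pi / 2), (2 * Real.sin α * Real.cos α) •
      ((fun x : ℝ => (x : ℂ) ^ ((b + 1) / 2 - 1) * ((1 - x : ℝ) : ℂ) ^ ((a + 1) / 2 - 1)) ∘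
        fun α => Real.sin α ^ 2) α =
      ∫ α in (0 : ℝ)..(Real.pi / 2), 2 * ((Real.cos α : ℂ) ^ a * (Real.sin α : ℂ) ^ b) := by
    refine intervalIntegral.integral_congr fun α hα => ?_
    have hc := cos_nonneg_of_mem_uIcc hα
    have hs := sin_nonneg_of_mem_uIcc hα
    have key : ∀ {x : ℝ} {a : ℂ}, 0 ≤ x → 1 < a.re →
        (x : ℂ) * ((x ^ 2 : ℝ) : ℂ) ^ ((a + 1) / 2 - 1) = (x : ℂ) ^ a := fun {x a} hx ha => by
      have ha0 : a ≠ 0 := fun h => by simp [h] at ha; linarith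
      rcases hx.eq_or_lt with rfl | hx
      · simp [Complex.zero_cpow ha0]
      · have hx0 : (x : ℂ) ≠ 0 := by exact_mod_cast hx.ne'
        push_cast
        rw [ofReal_sq_cpow hx, show 2 * ((a + 1) / 2 - 1) = a - 1 by ring,
          Complex.cpow_sub _ _ hx0, Complex.cpow_one]
        field_simp
    have e : (1 - Real.sin α ^ 2 : ℝ) = Real.cos α ^ 2 := (Real.cos_sq' α).symm
    simp only [Function.comp, Complex.real_smul]
    rw [e, ← key hc ha, ← key hs hb]
    push_cast
    ring
  rw [hI, intervalIntegral.integral_const_mul] at hs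
  rw [eq_div_iff (by simpa using hG)]
  linear_combination Complex.Gamma ((a + b + 2) / 2) * hs - hβ

/-- The closed form of `trigMoment`. -/
noncomputable def trigMomentValue (m : ℤ) (σ : ℂ) : ℂ :=
  Complex.Gamma (σ + 1) * (2 : ℂ) ^ (-2 * σ) * Real.pi * Complex.exp (Complex.I * m * Real.pi / 4) *
    (Complex.Gamma ((2 * σ + 4 + m) / 4))⁻¹ * (Complex.Gamma ((2 * σ + 4 - m) / 4))⁻¹ / 2

theorem trigMomentValue_neg (m : ℤ) (σ : ℂ) : trigMomentValue m σ =
    Complex.exp (Complex.I * m * (Real.pi / 2)) * trigMomentValue (-m) σ := by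
  have e : Complex.exp (Complex.I * m * Real.pi / 4) = Complex.exp (Complex.I * m * (Real.pi / 2)) *
      Complex.exp (Complex.I * (-m : ℤ) * Real.pi / 4) := by
    rw [← Complex.exp_add]
    congr 1
    push_cast; ring
  rw [trigMomentValue, trigMomentValue, e]
  push_cast
  rw [sub_neg_eq_add, ← sub_eq_add_neg]
  ring

/-- The identity 1/Γ(z) = z/Γ(z+1) holds for every z, poles included, and the two exponentials
differ by the factor e^{iπ} = -1. -/
theorem trigMomentValue_step (m : ℤ) (σ : ℂ) :
    (2 * (σ + 1) + m) * trigMomentValue (m + 2) σ +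
      (2 * (σ + 1) - m) * trigMomentValue (m - 2) σ = 0 := by
  have e : Complex.exp (Complex.I * (m + 2 : ℤ) * Real.pi / 4) =
      -Complex.exp (Complex.I * (m - 2 : ℤ) * Real.pi / 4) := by
    rw [← mul_neg_one, ← Complex.exp_pi_mul_I, ← Complex.exp_add]
    congr 1
    push_cast; ring
  have g1 := Complex.one_div_Gamma_eq_self_mul_one_div_Gamma_add_one ((2 * (σ + 1) + m) / 4)
  have g2 := Complex.one_div_Gamma_eq_self_mul_one_div_Gamma_add_one ((2 * (σ + 1) - m) / 4)
  rw [trigMomentValue, trigMomentValue, e]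
  push_cast
  rw [show (2 * σ + 4 + ((m : ℂ) + 2)) / 4 = (2 * (σ + 1) + m) / 4 + 1 by ring,
    show (2 * σ + 4 - ((m : ℂ) + 2)) / 4 = (2 * (σ + 1) - m) / 4 by ring,
    show (2 * σ + 4 + ((m : ℂ) - 2)) / 4 = (2 * (σ + 1) + m) / 4 by ring,
    show (2 * σ + 4 - ((m : ℂ) - 2)) / 4 = (2 * (σ + 1) - m) / 4 + 1 by ring, g1, g2]
  ring

/-- Duplication, in the form used for the moments. -/
theorem Gamma_half_mul_Gamma (σ : ℂ) :
    Complex.Gamma ((σ + 1) / 2) * Complex.Gamma ((σ + 2) / 2) =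
      Complex.Gamma (σ + 1) * (2 : ℂ) ^ (-σ) * (√Real.pi : ℝ) := by
  have d := Complex.Gamma_mul_Gamma_add_half ((σ + 1) / 2)
  rw [show (σ + 1) / 2 + 1 / 2 = (σ + 2) / 2 by ring, show 2 * ((σ + 1) / 2) = σ + 1 by ring,
    show 1 - (σ + 1) = -σ by ring] at d
  exact d

theorem sqrt_pi_sq : ((√Real.pi : ℝ) : ℂ) ^ 2 = Real.pi := by
  exact_mod_cast Real.sq_sqrt Real.pi_pos.le

theorem two_cpow_neg_sq (σ : ℂ) : ((2 : ℂ) ^ (-σ)) ^ 2 = (2 : ℂ) ^ (-2 * σ) := by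
  rw [← Complex.cpow_nat_mul]
  congr 1
  push_cast; ring

theorem trigMoment_eq_of_zero {σ : ℂ} (hσ : 1 < σ.re) :
    trigMoment 0 σ = trigMomentValue 0 σ := by
  have h : trigMoment 0 σ =
      ∫ α in (0 : ℝ)..(Real.pi / 2), (Real.cos α : ℂ) ^ σ * (Real.sin α : ℂ) ^ σ := by
    refine intervalIntegral.integral_congr fun α hα => ?_
    simp only [Int.cast_zero, mul_zero, zero_mul, Complex.exp_zero, mul_one, Complex.ofReal_mul]
    exact Complex.mul_cpow_ofReal_nonneg (cos_nonneg_of_mem_uIcc hα) (sin_nonneg_of_mem_uIcc hα) σ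
  rw [h, integral_cos_cpow_mul_sin_cpow hσ hσ, trigMomentValue]
  have d := Gamma_half_mul_Gamma σ
  have g1 : Complex.Gamma ((σ + 2) / 2) ≠ 0 :=
    Complex.Gamma_ne_zero_of_re_pos (by simp; linarith)
  have g2 : Complex.Gamma (σ + 1) ≠ 0 := Complex.Gamma_ne_zero_of_re_pos (by simp; linarith)
  have p := sqrt_pi_sq
  have w := two_cpow_neg_sq σ
  rw [← w, ← p]
  simp only [Int.cast_zero, add_zero, sub_zero, mul_zero, zero_mul, zero_div, Complex.exp_zero]
  rw [show (σ + σ + 2) / 2 = σ + 1 by ring, show (2 * σ + 4) / 4 = (σ + 2) / 2 by ring]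
  have g3 : Complex.Gamma ((σ + 1) / 2) = Complex.Gamma (σ + 1) * (2 : ℂ) ^ (-σ) *
      (√Real.pi : ℝ) / Complex.Gamma ((σ + 2) / 2) := by
    rw [eq_div_iff g1, d]
  rw [g3]
  field_simp

theorem exp_pi_div_four :
    Complex.exp (Complex.I * Real.pi / 4) = (2 : ℂ) ^ (-(1 / 2) : ℂ) * (1 + Complex.I) := by
  have h1 : (2 : ℂ) ^ (-(1 / 2) : ℂ) = ((√2 / 2 : ℝ) : ℂ) := by
    have : (2 : ℝ) ^ (-(1 / 2) : ℝ) = √2 / 2 := by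
      rw [Real.rpow_neg two_pos.le, ← Real.sqrt_eq_rpow, inv_eq_one_div, Real.sqrt_div_self']
    rw [← this, Complex.ofReal_cpow two_pos.le]
    push_cast; rfl
  rw [show Complex.I * Real.pi / 4 = ((Real.pi / 4 : ℝ) : ℂ) * Complex.I by push_cast; ring,
    Complex.exp_mul_I, ← Complex.ofReal_cos, ← Complex.ofReal_sin, Real.cos_pi_div_four,
    Real.sin_pi_div_four, h1]
  ring

/-- Splitting e^{iα} = cos α + i sin α gives two equal beta integrals. Their factor 1 + i is √2
e^{iπ/4}, and duplication is applied to two pairs of Gamma factors. -/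
theorem trigMoment_eq_of_one {σ : ℂ} (hσ : 1 < σ.re) :
    trigMoment 1 σ = trigMomentValue 1 σ := by
  have hσ1 : 1 < (σ + 1).re := by simp; linarith
  have cont : ∀ {a b : ℂ}, 1 < a.re → 1 < b.re → IntervalIntegrable
      (fun α : ℝ => (Real.cos α : ℂ) ^ a * (Real.sin α : ℂ) ^ b) volume 0 (Real.pi / 2) :=
    fun ha hb => (((Complex.continuous_ofReal_cpow_const (by linarith)).comp
      Real.continuous_cos).mul ((Complex.continuous_ofReal_cpow_const (by linarith)).comp
      Real.continuous_sin)).intervalIntegrable _ _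
  have key : ∀ {x : ℝ} {a : ℂ}, 0 ≤ x → 1 < a.re → (x : ℂ) ^ (a + 1) = x * (x : ℂ) ^ a :=
    fun {x a} hx ha => by
      rcases hx.eq_or_lt with rfl | hx
      · have h1 : a + 1 ≠ 0 := fun h => by
          have := congrArg Complex.re h
          simp at this
          linarith
        simp [Complex.zero_cpow h1]
      · rw [Complex.cpow_add _ _ (by exact_mod_cast hx.ne'), Complex.cpow_one, mul_comm]
  have h : trigMoment 1 σ = ∫ α in (0 : ℝ)..(Real.pi / 2),
      ((Real.cos α : ℂ) ^ (σ + 1) * (Real.sin α : ℂ) ^ σ + Complex.I *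
        ((Real.cos α : ℂ) ^ σ * (Real.sin α : ℂ) ^ (σ + 1))) := by
    refine intervalIntegral.integral_congr fun α hα => ?_
    have hc := cos_nonneg_of_mem_uIcc hα
    have hs := sin_nonneg_of_mem_uIcc hα
    simp only [Int.cast_one, mul_one]
    rw [key hc hσ, key hs hσ, Complex.ofReal_mul, Complex.mul_cpow_ofReal_nonneg hc hs,
      mul_comm Complex.I, Complex.exp_mul_I, ← Complex.ofReal_cos, ← Complex.ofReal_sin]
    ring
  rw [h, intervalIntegral.integral_add (cont hσ1 hσ) ((cont hσ hσ1).const_mul _),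
    intervalIntegral.integral_const_mul, integral_cos_cpow_mul_sin_cpow hσ hσ1,
    integral_cos_cpow_mul_sin_cpow hσ1 hσ, trigMomentValue]
  have d := Gamma_half_mul_Gamma σ
  have d' := Complex.Gamma_mul_Gamma_add_half ((2 * σ + 3) / 4)
  have g1 : Complex.Gamma ((σ + 2) / 2) ≠ 0 :=
    Complex.Gamma_ne_zero_of_re_pos (by simp; linarith)
  have g2 : Complex.Gamma (σ + 3 / 2) ≠ 0 := Complex.Gamma_ne_zero_of_re_pos (by simp; linarith)
  have g4 : (2 : ℂ) ^ (-σ) ≠ 0 := by simp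
  have g5 : (2 : ℂ) ^ (-(1 / 2) : ℂ) ≠ 0 := by simp
  have g6 : ((√Real.pi : ℝ) : ℂ) ≠ 0 := by
    exact_mod_cast (Real.sqrt_pos.2 Real.pi_pos).ne'
  have g3 : Complex.Gamma ((σ + 1) / 2) = Complex.Gamma (σ + 1) * (2 : ℂ) ^ (-σ) *
      (√Real.pi : ℝ) / Complex.Gamma ((σ + 2) / 2) := by
    rw [eq_div_iff g1, d]
  rw [show (2 * σ + 3) / 4 + 1 / 2 = (2 * σ + 5) / 4 by ring,
    show 2 * ((2 * σ + 3) / 4) = σ + 3 / 2 by ring,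
    show 1 - (σ + 3 / 2) = -σ + -(1 / 2) by ring, Complex.cpow_add _ _ two_ne_zero] at d'
  rw [Int.cast_one, mul_one, exp_pi_div_four, mul_assoc _ (Complex.Gamma _)⁻¹, ← mul_inv,
    show (2 * σ + 4 - 1) / 4 = (2 * σ + 3) / 4 by ring,
    show (2 * σ + 4 + 1) / 4 = (2 * σ + 5) / 4 by ring, mul_comm (Complex.Gamma ((2 * σ + 5) / 4)),
    d', ← two_cpow_neg_sq, ← sqrt_pi_sq, show (σ + (σ + 1) + 2) / 2 = σ + 3 / 2 by ring,
    show (σ + 1 + σ + 2) / 2 = σ + 3 / 2 by ring, show (σ + 1 + 1) / 2 = (σ + 2) / 2 by ring, g3]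
  field_simp

/-- The recurrence at m = 0 gives only that the moments for 2 and -2 are opposite, as does
reflection. Their difference supplies the missing datum: e^{2iα} - e^{-2iα} = 4i cos α sin α, a beta
integral at level σ+1. -/
theorem trigMoment_eq_of_two {σ : ℂ} (hσ : 1 < σ.re) :
    trigMoment 2 σ = trigMomentValue 2 σ := by
  have hσ1 : 1 < (σ + 1).re := by simp; linarith
  have hσ0 : 0 < σ.re := by linarith
  have hne : σ + 1 ≠ 0 := fun h => by simp [h] at hσ1; linarith
  have key : ∀ {x : ℝ}, 0 ≤ x → (x : ℂ) ^ (σ + 1) = x * (x : ℂ) ^ σ :=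
    fun {x} hx => by
      rcases hx.eq_or_lt with rfl | hx
      · simp [Complex.zero_cpow hne]
      · rw [Complex.cpow_add _ _ (by exact_mod_cast hx.ne'), Complex.cpow_one, mul_comm]
  have h : trigMoment 2 σ - trigMoment (-2) σ = ∫ α in (0 : ℝ)..(Real.pi / 2),
      4 * Complex.I * ((Real.cos α : ℂ) ^ (σ + 1) * (Real.sin α : ℂ) ^ (σ + 1)) := by
    rw [trigMoment, trigMoment, ← intervalIntegral.integral_sub
      ((continuous_trigMoment_integrand 2 hσ0).intervalIntegrable _ _)
      ((continuous_trigMoment_integrand (-2) hσ0).intervalIntegrable _ _)]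
    refine intervalIntegral.integral_congr fun α hα => ?_
    have hc := cos_nonneg_of_mem_uIcc hα
    have hs := sin_nonneg_of_mem_uIcc hα
    have e1 : Complex.exp (Complex.I * (2 : ℤ) * α) =
        (Complex.cos α + Complex.sin α * Complex.I) ^ 2 := by
      rw [← Complex.exp_mul_I, ← Complex.exp_nat_mul]
      congr 1
      push_cast; ring
    have e2 : Complex.exp (Complex.I * (-2 : ℤ) * α) =
        (Complex.cos α - Complex.sin α * Complex.I) ^ 2 := by
      have : Complex.cos α - Complex.sin α * Complex.I = Complex.exp (-α * Complex.I) := by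
        rw [Complex.exp_mul_I, Complex.cos_neg, Complex.sin_neg]; ring
      rw [this, ← Complex.exp_nat_mul]
      congr 1
      push_cast; ring
    rw [e1, e2, ← Complex.mul_cpow_ofReal_nonneg hc hs, ← Complex.ofReal_mul,
      key (mul_nonneg hc hs), Complex.ofReal_mul, Complex.ofReal_cos, Complex.ofReal_sin]
    ring
  rw [intervalIntegral.integral_const_mul, integral_cos_cpow_mul_sin_cpow hσ1 hσ1] at h
  have hstep := trigMoment_step 0 hσ0
  have hsum : trigMoment 2 σ + trigMoment (-2) σ = 0 := by
    have h2 : 2 * (σ + 1) ≠ 0 := mul_ne_zero two_ne_zero hne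
    refine (mul_eq_zero.1 (?_ : 2 * (σ + 1) * _ = 0)).resolve_left h2
    simp only [Int.cast_zero, zero_add, zero_sub, add_zero, sub_zero] at hstep
    linear_combination hstep
  have d := Gamma_half_mul_Gamma σ
  have g0 : Complex.Gamma ((σ + 1) / 2) ≠ 0 :=
    Complex.Gamma_ne_zero_of_re_pos (by simp; linarith)
  have g2 : Complex.Gamma (σ + 1) ≠ 0 := Complex.Gamma_ne_zero_of_re_pos (by simp; linarith)
  have g3 : Complex.Gamma ((σ + 2) / 2) = Complex.Gamma (σ + 1) * (2 : ℂ) ^ (-σ) *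
      (√Real.pi : ℝ) / Complex.Gamma ((σ + 1) / 2) := by
    rw [eq_div_iff g0, ← d, mul_comm]
  have g4 := Complex.Gamma_add_one (σ + 1) hne
  have g5 := Complex.Gamma_add_one ((σ + 1) / 2) (by simpa using hne)
  have e : Complex.exp (Complex.I * (2 : ℤ) * Real.pi / 4) = Complex.I := by
    rw [show Complex.I * (2 : ℤ) * Real.pi / 4 = Real.pi / 2 * Complex.I by push_cast; ring,
      Complex.exp_pi_div_two_mul_I]
  rw [trigMomentValue, e]
  push_cast
  rw [show (2 * σ + 4 + 2) / 4 = (σ + 1) / 2 + 1 by ring,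
    show (2 * σ + 4 - 2) / 4 = (σ + 1) / 2 by ring, g5, ← two_cpow_neg_sq, ← sqrt_pi_sq]
  rw [show (σ + 1 + (σ + 1) + 2) / 2 = σ + 1 + 1 by ring,
    show (σ + 1 + 1) / 2 = (σ + 2) / 2 by ring, g4, g3] at h
  have h3 : trigMoment 2 σ = (4 * Complex.I * (Complex.Gamma (σ + 1) * (2 : ℂ) ^ (-σ) *
      (√Real.pi : ℝ) / Complex.Gamma ((σ + 1) / 2) * (Complex.Gamma (σ + 1) * (2 : ℂ) ^ (-σ) *
      (√Real.pi : ℝ) / Complex.Gamma ((σ + 1) / 2)) /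
      (2 * ((σ + 1) * Complex.Gamma (σ + 1))))) / 2 := by
    linear_combination (h + hsum) / 2
  rw [h3]
  field_simp
  norm_num

/-- The recurrence moves m by 4 and the coefficient 2(σ+1) + n is nonzero for n ≥ 0. The cases 0, 1,
2 and the passage from -1 to 3 thus start the induction; reflection gives negative m. -/
theorem trigMoment_eq (m : ℤ) {σ : ℂ} (hσ : 1 < σ.re) :
    trigMoment m σ = trigMomentValue m σ := by
  have neg : ∀ m : ℤ, trigMoment m σ = trigMomentValue m σ →
      trigMoment (-m) σ = trigMomentValue (-m) σ := fun m h => by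
    rw [trigMoment_neg, trigMomentValue_neg (-m), neg_neg, h]
  have step : ∀ n : ℕ, trigMoment ((n : ℤ) - 2) σ = trigMomentValue ((n : ℤ) - 2) σ →
      trigMoment ((n : ℤ) + 2) σ = trigMomentValue ((n : ℤ) + 2) σ := fun n h => by
    have h1 := trigMoment_step n (σ := σ) (by linarith)
    have h2 := trigMomentValue_step n σ
    have h0 : 2 * (σ + 1) + ((n : ℤ) : ℂ) ≠ 0 := fun h => by
      have := congrArg Complex.re h
      simp at this
      have hn : (0 : ℝ) ≤ n := n.cast_nonneg
      linarith
    refine mul_left_cancel₀ h0 ?_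
    rw [h] at h1
    linear_combination h1 - h2
  have nat : ∀ n : ℕ, trigMoment n σ = trigMomentValue n σ := by
    intro n
    induction n using Nat.strong_induction_on with
    | _ n ih =>
      match n with
      | 0 => exact trigMoment_eq_of_zero hσ
      | 1 => exact trigMoment_eq_of_one hσ
      | 2 => exact trigMoment_eq_of_two hσ
      | 3 => simpa using step 1 (by simpa using neg 1 (trigMoment_eq_of_one hσ))
      | n + 4 =>
        have := step (n + 2) (by simpa using ih n (by omega))
        push_cast at this ⊢
        rwa [show (n : ℤ) + 4 = n + 2 + 2 by ring]
  obtain ⟨n, rfl | rfl⟩ := m.eq_nat_or_neg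
  · exact nat n
  · exact neg _ (nat n)

/-! ### The value at the base point -/

/-- The product of the two Gamma factors is even in m, so replacing m by |m| changes nothing. -/
theorem Gamma_mul_cCoeff (m : ℤ) (σ : ℂ) :
    Complex.Gamma (σ + 1) * cCoeff m (2 * σ + 1) = 2 * trigMomentValue m σ := by
  rw [cCoeff, trigMomentValue, show 1 - (2 * σ + 1) = -2 * σ by ring, div_eq_mul_inv, mul_inv]
  rcases abs_choice m with h | h <;> rw [h] <;> push_cast
  · rw [show 2 * σ + 1 + 3 = 2 * σ + 4 by ring]
    ring
  · rw [show 2 * σ + 1 + 3 = 2 * σ + 4 by ring, ← sub_eq_add_neg, sub_neg_eq_add]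
    ring

theorem neg_one_pow_val_intCast (m : ℤ) : (-1 : ℂ) ^ (m : ZMod 2).val = (-1) ^ m := by
  have hv : ((m : ZMod 2).val : ℤ) = m % 2 := by
    rw [ZMod.val_intCast]; rfl
  rw [← zpow_natCast, hv]
  rcases Int.even_or_odd m with hm | hm
  · rw [hm.neg_one_zpow, Int.even_iff.mp hm, zpow_zero]
  · rw [hm.neg_one_zpow, Int.odd_iff.mp hm, zpow_one]

theorem neg_one_pow_val_add (a b : ZMod 2) :
    (-1 : ℂ) ^ (a + b).val = (-1) ^ a.val * (-1) ^ b.val := by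
  rw [ZMod.val_add, ← neg_one_pow_eq_pow_mod_two, pow_add]

theorem exp_I_mul_int_mul_pi (m : ℤ) : Complex.exp (Complex.I * m * Real.pi) = (-1) ^ m := by
  rw [← Complex.exp_pi_mul_I, ← Complex.exp_int_mul]
  congr 1
  ring

theorem exp_I_mul_int_mul_pi_div_two (m : ℤ) :
    Complex.exp (Complex.I * m * (Real.pi / 2 : ℝ)) = Complex.I ^ m := by
  rw [show Complex.I ^ m = Complex.exp (Real.pi / 2 * Complex.I) ^ m by
    rw [Complex.exp_pi_div_two_mul_I], ← Complex.exp_int_mul]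
  congr 1
  push_cast; ring

/-- The value of the Poisson integral at the base point. -/
theorem angIntegral_zero (ε ξ : ZMod 2) {m : ℤ} (hm : (m : ZMod 2) = ε) {σ : ℂ} (hσ : 1 < σ.re) :
    angIntegral (ξ + ε) ξ m σ 0 = omega m ξ * (Complex.Gamma (σ + 1) * cCoeff m (2 * σ + 1)) := by
  have hσ0 : σ ≠ 0 := fun h => by simp [h] at hσ; linarith
  rw [Gamma_mul_cCoeff, ← trigMoment_eq m hσ]
  have hint : ∀ a b, IntervalIntegrable (fun α : ℝ =>
      angKernel (ξ + ε) ξ σ 0 α * Complex.exp (Complex.I * m * α)) volume a b := fun a b => by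
    have hexp : Continuous fun p : ℝ × ℝ => Complex.exp (Complex.I * m * p.2) := by fun_prop
    exact (((continuous_angKernel _ _ hσ).mul hexp).comp
      (Continuous.prodMk_right 0)).intervalIntegrable _ _
  have hsgn : (-1 : ℂ) ^ (ξ + ε).val * (-1) ^ ξ.val = (-1) ^ m := by
    rw [neg_one_pow_val_add, ← hm, neg_one_pow_val_intCast, mul_right_comm, ← mul_pow]
    simp
  have hmm : ((-1 : ℂ) ^ m) * (-1) ^ m = 1 := by
    rw [← mul_zpow]; simp
  have hξ : ((-1 : ℂ) ^ ξ.val) * (-1) ^ ξ.val = 1 := by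
    rw [← mul_pow]; simp
  -- A shift by π negates both entries and multiplies the exponential by (-1)^m. As m ≡ ε, the signs
  -- cancel, and the full circle is twice a half circle. The two quarters below carry the signs
  -- (-1)^ξ and (-1)^m i^m, whose sum is ω.
  have per : ∀ α : ℝ, angKernel (ξ + ε) ξ σ 0 (α + Real.pi) *
      Complex.exp (Complex.I * m * (α + Real.pi : ℝ)) =
      angKernel (ξ + ε) ξ σ 0 α * Complex.exp (Complex.I * m * α) := fun α => by
    have hA : entryA 0 (α + Real.pi) = -entryA 0 α := by simp [entryA]
    have hB : entryB 0 (α + Real.pi) = -entryB 0 α := by simp [entryB]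
    rw [angKernel, angKernel, hA, hB, signedPow_neg, signedPow_neg, Complex.ofReal_add, mul_add,
      Complex.exp_add, exp_I_mul_int_mul_pi]
    linear_combination (signedPow (ξ + ε) σ (entryA 0 α) * signedPow ξ σ (entryB 0 α) *
      Complex.exp (Complex.I * m * α)) * ((-1 : ℂ) ^ m * hsgn + hmm)
  have first : ∫ α in (0 : ℝ)..(Real.pi / 2), angKernel (ξ + ε) ξ σ 0 α *
      Complex.exp (Complex.I * m * α) = (-1) ^ ξ.val * trigMoment m σ := by
    rw [trigMoment, ← intervalIntegral.integral_const_mul]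
    refine intervalIntegral.integral_congr fun α hα => ?_
    have hc := cos_nonneg_of_mem_uIcc hα
    have hs := sin_nonneg_of_mem_uIcc hα
    have hA : entryA 0 α = Real.cos α := by simp [entryA]
    have hB : entryB 0 α = -Real.sin α := by simp [entryB]
    simp only [angKernel]
    rw [hA, hB, signedPow_neg, signedPow_of_nonneg _ hσ0 hc, signedPow_of_nonneg _ hσ0 hs,
      Complex.ofReal_mul, Complex.mul_cpow_ofReal_nonneg hc hs]
    ring
  have second : ∫ α in (Real.pi / 2)..Real.pi, angKernel (ξ + ε) ξ σ 0 α *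
      Complex.exp (Complex.I * m * α) = (-1) ^ m * Complex.I ^ m * trigMoment m σ := by
    have hshift := intervalIntegral.integral_comp_add_right (a := 0) (b := Real.pi / 2)
      (fun α : ℝ => angKernel (ξ + ε) ξ σ 0 α * Complex.exp (Complex.I * m * α)) (Real.pi / 2)
    rw [zero_add, add_halves] at hshift
    rw [← hshift, trigMoment, ← intervalIntegral.integral_const_mul]
    refine intervalIntegral.integral_congr fun α hα => ?_
    have hc := cos_nonneg_of_mem_uIcc hα
    have hs := sin_nonneg_of_mem_uIcc hα
    have hA : entryA 0 (α + Real.pi / 2) = -Real.sin α := by simp [entryA, Real.cos_add_pi_div_two]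
    have hB : entryB 0 (α + Real.pi / 2) = -Real.cos α := by simp [entryB, Real.sin_add_pi_div_two]
    simp only [angKernel]
    rw [hA, hB, signedPow_neg, signedPow_neg, signedPow_of_nonneg _ hσ0 hc,
      signedPow_of_nonneg _ hσ0 hs, Complex.ofReal_mul, Complex.mul_cpow_ofReal_nonneg hc hs,
      Complex.ofReal_add, mul_add, Complex.exp_add, exp_I_mul_int_mul_pi_div_two, ← hsgn]
    ring
  have half : ∫ α in (0 : ℝ)..Real.pi, angKernel (ξ + ε) ξ σ 0 α *
      Complex.exp (Complex.I * m * α) = omega m ξ * trigMoment m σ := by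
    rw [← intervalIntegral.integral_add_adjacent_intervals (hint 0 (Real.pi / 2)) (hint _ _),
      first, second, omega]
    ring
  have hshift := intervalIntegral.integral_comp_add_right (a := 0) (b := Real.pi)
    (fun α : ℝ => angKernel (ξ + ε) ξ σ 0 α * Complex.exp (Complex.I * m * α)) Real.pi
  rw [zero_add, ← two_mul] at hshift
  rw [angIntegral, ← intervalIntegral.integral_add_adjacent_intervals (hint 0 Real.pi) (hint _ _),
    ← hshift]
  simp only [per]
  rw [half]
  ring

/-! ### Integrability and holomorphy in the exponent -/

/-- One η moves the exponent from x to r ± η; the other absorbs the logarithm through log q ≤ q^η/η,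
applied to q or to 1/q. -/
theorem rpow_mul_abs_log_le {q x r η : ℝ} (hq : 0 < q) (hη : 0 < η) (hx : |x - r| ≤ η) :
    q ^ x * |Real.log q| ≤ (q ^ (r - 2 * η) + q ^ (r + 2 * η)) / η := by
  obtain ⟨h1, h2⟩ := abs_le.1 hx
  have p1 : 0 ≤ q ^ (r - 2 * η) := by positivity
  have p2 : 0 ≤ q ^ (r + 2 * η) := by positivity
  rcases le_total 1 q with h | h
  · rw [abs_of_nonneg (Real.log_nonneg h)]
    calc q ^ x * Real.log q ≤ q ^ (r + η) * (q ^ η / η) := by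
          have := Real.log_le_rpow_div hq.le hη
          have := Real.rpow_le_rpow_of_exponent_le h (show x ≤ r + η by linarith)
          have := Real.log_nonneg h
          gcongr
      _ = q ^ (r + 2 * η) / η := by
          rw [← mul_div_assoc, ← Real.rpow_add hq]
          ring_nf
      _ ≤ _ := by gcongr; linarith
  · rw [abs_of_nonpos (Real.log_nonpos hq.le h)]
    calc q ^ x * -Real.log q ≤ q ^ (r - η) * (q ^ (-η) / η) := by
          have h3 := Real.log_le_rpow_div (inv_nonneg.2 hq.le) hη
          rw [Real.log_inv, Real.inv_rpow hq.le, ← Real.rpow_neg hq.le] at h3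
          have := Real.rpow_le_rpow_of_exponent_ge hq h (show r - η ≤ x by linarith)
          have := neg_nonneg.2 (Real.log_nonpos hq.le h)
          gcongr
      _ = q ^ (r - 2 * η) / η := by
          rw [← mul_div_assoc, ← Real.rpow_add hq]
          ring_nf
      _ ≤ _ := by gcongr; linarith

/-- Integrals of complex powers of a nonnegative function are holomorphic in the exponent. -/
theorem differentiableAt_integral_cpow {w : ℝ → ℂ} {q : ℝ → ℝ} {a b : ℝ} (hw : Measurable w)
    (hw1 : ∀ t, ‖w t‖ ≤ 1) (hq : Measurable q) (hq0 : ∀ᵐ t, 0 < q t)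
    (hint : ∀ r : ℝ, -1 < r → IntervalIntegrable (fun t => q t ^ r) volume a b) {σ : ℂ}
    (hσ : -1 < σ.re) :
    IntervalIntegrable (fun t => w t * (q t : ℂ) ^ σ) volume a b ∧
      DifferentiableAt ℂ (fun σ : ℂ => ∫ t in a..b, w t * (q t : ℂ) ^ σ) σ := by
  have hm : ∀ σ : ℂ, Measurable fun t => w t * (q t : ℂ) ^ σ := fun σ =>
    hw.mul ((Complex.measurable_ofReal.comp hq).pow_const σ)
  have hi : IntervalIntegrable (fun t => w t * (q t : ℂ) ^ σ) volume a b := by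
    refine (hint σ.re hσ).mono_fun' (hm σ).aestronglyMeasurable ?_
    filter_upwards [ae_restrict_of_ae hq0] with t ht
    rw [norm_mul, Complex.norm_cpow_eq_rpow_re_of_pos ht]
    exact mul_le_of_le_one_left (by positivity) (hw1 t)
  refine ⟨hi, ?_⟩
  -- A third of the distance to the line Re = -1, so that the exponent Re σ - 2η of the dominating
  -- function still exceeds -1.
  set η : ℝ := (σ.re + 1) / 3 with hη
  have hη0 : 0 < η := by rw [hη]; linarith
  refine (intervalIntegral.hasDerivAt_integral_of_dominated_loc_of_deriv_le
    (F' := fun σ t => w t * ((q t : ℂ) ^ σ * Complex.log (q t)))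
    (bound := fun t => (q t ^ (σ.re - 2 * η) + q t ^ (σ.re + 2 * η)) / η)
    (Metric.ball_mem_nhds σ hη0)
    (Eventually.of_forall fun σ => (hm σ).aestronglyMeasurable) hi ?_ ?_ ?_ ?_).2.differentiableAt
  · have : Measurable fun t => w t * ((q t : ℂ) ^ σ * Complex.log (q t)) :=
      hw.mul (((Complex.measurable_ofReal.comp hq).pow_const σ).mul
        (Complex.measurable_log.comp (Complex.measurable_ofReal.comp hq)))
    exact this.aestronglyMeasurable
  · filter_upwards [hq0] with t ht _ x hx
    rw [norm_mul, norm_mul, Complex.norm_cpow_eq_rpow_re_of_pos ht, ← Complex.ofReal_log ht.le,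
      Complex.norm_real, Real.norm_eq_abs]
    refine (mul_le_of_le_one_left (by positivity) (hw1 t)).trans
      (rpow_mul_abs_log_le ht hη0 ?_)
    have h1 := Complex.abs_re_le_norm (x - σ)
    rw [Metric.mem_ball, dist_eq_norm] at hx
    simpa using h1.trans hx.le
  · exact ((hint _ (by linarith)).add (hint _ (by linarith))).div_const _
  · filter_upwards [hq0] with t ht _ x _
    exact ((hasDerivAt_id x).const_cpow (Or.inl (by exact_mod_cast ht.ne'))).const_mul (w t)
      |>.congr_deriv (by simp)

/-- Jordan's inequality sin α ≥ 2α/π compares with α^r on the first quarter; reflection and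
π-periodicity do the rest. -/
theorem intervalIntegrable_abs_sin_rpow {r : ℝ} (hr : -1 < r) (hr0 : r < 0) (a b : ℝ) :
    IntervalIntegrable (fun α => |Real.sin α| ^ r) volume a b := by
  have hpi := Real.pi_pos
  have hm : Measurable fun α => |Real.sin α| ^ r :=
    (Real.measurable_sin.abs).pow_const r
  have h1 : IntervalIntegrable (fun α => |Real.sin α| ^ r) volume 0 (Real.pi / 2) := by
    refine ((intervalIntegral.intervalIntegrable_rpow' hr).const_mul ((2 / Real.pi) ^ r)).mono_fun'
      hm.aestronglyMeasurable ?_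
    filter_upwards [ae_restrict_mem measurableSet_uIoc] with α hα
    rw [Set.uIoc_of_le (by positivity)] at hα
    have h2 := Real.mul_le_sin hα.1.le hα.2
    have h3 : 0 < 2 / Real.pi * α := mul_pos (by positivity) hα.1
    rw [Real.norm_of_nonneg (by positivity), ← Real.mul_rpow (by positivity) hα.1.le,
      abs_of_pos (h3.trans_le h2)]
    exact Real.rpow_le_rpow_of_nonpos h3 h2 hr0.le
  have h2 : IntervalIntegrable (fun α => |Real.sin α| ^ r) volume (Real.pi / 2) Real.pi := by
    have := (h1.comp_sub_left Real.pi).symm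
    simp only [Real.sin_pi_sub, sub_zero] at this
    rwa [sub_half] at this
  refine Function.Periodic.intervalIntegrable₀ (T := Real.pi) (fun α => ?_) hpi.ne'
    (h1.trans h2) a b
  simp [Real.sin_add_pi]

theorem exists_eq_mul_sin {x y : ℝ} (h : x ≠ 0 ∨ y ≠ 0) : ∃ R β : ℝ, 0 < R ∧
    ∀ α, x * Real.cos α + y * Real.sin α = R * Real.sin (α + β) := by
  refine ⟨‖(⟨y, x⟩ : ℂ)‖, Complex.arg ⟨y, x⟩, norm_pos_iff.2 fun h0 => ?_, fun α => ?_⟩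
  · have h1 := congrArg Complex.re h0
    have h2 := congrArg Complex.im h0
    simp at h1 h2
    tauto
  · rw [Real.sin_add]
    have h1 := Complex.norm_mul_cos_arg ⟨y, x⟩
    have h2 := Complex.norm_mul_sin_arg ⟨y, x⟩
    simp only at h1 h2
    linear_combination (-Real.sin α) * h1 - Real.cos α * h2

theorem intervalIntegrable_abs_trig_rpow {x y : ℝ} (h : x ≠ 0 ∨ y ≠ 0) {r : ℝ} (hr : -1 < r)
    (hr0 : r < 0) (a b : ℝ) :
    IntervalIntegrable (fun α => |x * Real.cos α + y * Real.sin α| ^ r) volume a b := by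
  obtain ⟨R, β, hR, hα⟩ := exists_eq_mul_sin h
  have h1 := ((intervalIntegrable_abs_sin_rpow hr hr0 (a + β) (b + β)).comp_add_right β).const_mul
    (R ^ r)
  rw [add_sub_cancel_right, add_sub_cancel_right] at h1
  refine h1.congr ?_
  intro α _
  simp only
  rw [hα, abs_mul, abs_of_pos hR, Real.mul_rpow hR.le (abs_nonneg _)]

theorem ae_trig_ne_zero {x y : ℝ} (h : x ≠ 0 ∨ y ≠ 0) :
    ∀ᵐ α : ℝ, x * Real.cos α + y * Real.sin α ≠ 0 := by
  obtain ⟨R, β, hR, hα⟩ := exists_eq_mul_sin h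
  have hc : {α : ℝ | x * Real.cos α + y * Real.sin α = 0}.Countable := by
    refine (Set.countable_range fun n : ℤ => n * Real.pi - β).mono fun α hz => ?_
    have hz' : R * Real.sin (α + β) = 0 := by rw [← hα]; exact hz
    obtain ⟨n, hn⟩ := Real.sin_eq_zero_iff.1 ((mul_eq_zero.1 hz').resolve_left hR.ne')
    exact ⟨n, by simp only; linarith⟩
  filter_upwards [hc.ae_notMem volume] with α hα using hα

theorem entryA_eq (u α : ℝ) :
    entryA u α = Real.cosh u * Real.cos α + Real.sinh u * Real.sin α := by
  rw [entryA]; ring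

theorem entryB_eq (u α : ℝ) :
    entryB u α = -Real.sinh u * Real.cos α + -Real.cosh u * Real.sin α := by
  rw [entryB]; ring

theorem continuous_entryA (u : ℝ) : Continuous (entryA u) := by unfold entryA; fun_prop

theorem continuous_entryB (u : ℝ) : Continuous (entryB u) := by unfold entryB; fun_prop

/-- For r < 0 the two entries are never small together: A² + B² ≥ cosh 2u - |sinh 2u| > 0. One of
them is at least c in absolute value, so |AB|^r ≤ c^r (|A|^r + |B|^r). -/
theorem intervalIntegrable_abs_entry_mul_rpow (u : ℝ) {r : ℝ} (hr : -1 < r) (a b : ℝ) :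
    IntervalIntegrable (fun α => |entryA u α * entryB u α| ^ r) volume a b := by
  have hcont : Continuous fun α => |entryA u α * entryB u α| :=
    ((continuous_entryA u).mul (continuous_entryB u)).abs
  rcases le_or_gt 0 r with h0 | h0
  · exact (hcont.rpow_const fun _ => Or.inr h0).intervalIntegrable _ _
  have hch := Real.cosh_pos u
  have iA := intervalIntegrable_abs_trig_rpow (x := Real.cosh u) (y := Real.sinh u)
    (Or.inl hch.ne') hr h0 a b
  have iB := intervalIntegrable_abs_trig_rpow (x := -Real.sinh u) (y := -Real.cosh u)
    (Or.inr (neg_ne_zero.2 hch.ne')) hr h0 a b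
  simp only [← entryA_eq, ← entryB_eq] at iA iB
  set κ := Real.cosh (2 * u) - |Real.sinh (2 * u)| with hκ
  have hκ0 : 0 < κ := by
    have h1 := Real.cosh_sq (2 * u)
    have h2 := abs_lt_of_sq_lt_sq (show Real.sinh (2 * u) ^ 2 < Real.cosh (2 * u) ^ 2 by linarith)
      (Real.cosh_pos _).le
    linarith
  set c := √(κ / 2) with hc
  have hc0 : 0 < c := Real.sqrt_pos.2 (by positivity)
  have hc2 : c ^ 2 = κ / 2 := Real.sq_sqrt (by positivity)
  refine ((iA.add iB).const_mul (c ^ r)).mono_fun'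
    (hcont.measurable.pow_const r).aestronglyMeasurable ?_
  filter_upwards with α
  have hsum : κ ≤ entryA u α ^ 2 + entryB u α ^ 2 := by
    rw [entryA_sq_add_entryB_sq, hκ]
    have h1 : |Real.sinh (2 * u) * Real.sin (2 * α)| ≤ |Real.sinh (2 * u)| := by
      rw [abs_mul]
      exact mul_le_of_le_one_right (abs_nonneg _) (Real.abs_sin_le_one _)
    have := neg_abs_le (Real.sinh (2 * u) * Real.sin (2 * α))
    linarith
  rw [Real.norm_of_nonneg (by positivity), abs_mul,
    Real.mul_rpow (abs_nonneg _) (abs_nonneg _)]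
  have p1 : 0 ≤ |entryA u α| ^ r := by positivity
  have p2 : 0 ≤ |entryB u α| ^ r := by positivity
  have p3 : 0 ≤ c ^ r := by positivity
  rcases le_total (κ / 2) (entryA u α ^ 2) with h | h
  · have h1 : c ≤ |entryA u α| := abs_le_of_sq_le_sq' (by rw [hc2, sq_abs]; exact h)
      (abs_nonneg _) |>.2
    have h2 := Real.rpow_le_rpow_of_nonpos hc0 h1 h0.le
    calc _ ≤ c ^ r * |entryB u α| ^ r := by gcongr
      _ ≤ _ := by gcongr; linarith
  · have h1 : c ≤ |entryB u α| := abs_le_of_sq_le_sq' (by rw [hc2, sq_abs]; linarith)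
      (abs_nonneg _) |>.2
    have h2 := Real.rpow_le_rpow_of_nonpos hc0 h1 h0.le
    calc _ ≤ |entryA u α| ^ r * c ^ r := by gcongr
      _ ≤ _ := by
        rw [mul_comm]
        gcongr; linarith

theorem measurable_sign_pow (n : ℕ) :
    Measurable fun x : ℝ => ((SignType.sign x : ℝ) : ℂ) ^ n := by
  have h : Monotone fun x : ℝ => (SignType.sign x : ℝ) := fun x y hxy => by
    have key : ∀ a b : SignType, a ≤ b → (a : ℝ) ≤ b := fun a b hab => by
      cases a <;> cases b <;> first | exact absurd hab (by decide) | norm_num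
    exact key _ _ (SignType.sign.monotone hxy)
  exact (Complex.measurable_ofReal.comp h.measurable).pow_const n

theorem norm_sign_pow_le (n : ℕ) (x : ℝ) : ‖((SignType.sign x : ℝ) : ℂ) ^ n‖ ≤ 1 := by
  rw [norm_pow]
  refine pow_le_one₀ (norm_nonneg _) ?_
  rcases lt_trichotomy x 0 with h | h | h
  · simp [sign_neg h]
  · simp [h]
  · simp [sign_pos h]

theorem angKernel_eq_sign_mul (δ δ' : ZMod 2) (σ : ℂ) (u α : ℝ) : angKernel δ δ' σ u α =
    ((SignType.sign (entryA u α) : ℝ) : ℂ) ^ δ.val *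
      ((SignType.sign (entryB u α) : ℝ) : ℂ) ^ δ'.val *
      ((|entryA u α * entryB u α| : ℝ) : ℂ) ^ σ := by
  rw [angKernel, signedPow, signedPow, abs_mul, Complex.ofReal_mul,
    Complex.mul_cpow_ofReal_nonneg (abs_nonneg _) (abs_nonneg _)]
  ring

/-- The signs and the exponential form a weight of norm at most 1 independent of σ; only |AB|^σ
varies, and AB vanishes on a null set. -/
theorem differentiableAt_angIntegral (δ δ' : ZMod 2) (m : ℤ) (u : ℝ) {σ : ℂ} (hσ : -1 < σ.re) :
    IntervalIntegrable (fun α : ℝ => angKernel δ δ' σ u α * Complex.exp (Complex.I * m * α))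
      volume 0 (2 * Real.pi) ∧ DifferentiableAt ℂ (fun σ => angIntegral δ δ' m σ u) σ := by
  set w : ℝ → ℂ := fun α => ((SignType.sign (entryA u α) : ℝ) : ℂ) ^ δ.val *
      ((SignType.sign (entryB u α) : ℝ) : ℂ) ^ δ'.val * Complex.exp (Complex.I * m * α) with hw
  have hfun : ∀ (σ : ℂ) (α : ℝ), angKernel δ δ' σ u α * Complex.exp (Complex.I * m * α) =
      w α * ((|entryA u α * entryB u α| : ℝ) : ℂ) ^ σ := fun σ α => by
    rw [angKernel_eq_sign_mul, hw]; ring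
  have hch := Real.cosh_pos u
  have key := differentiableAt_integral_cpow (w := w) (q := fun α => |entryA u α * entryB u α|)
    (a := 0) (b := 2 * Real.pi) ?_ (fun α => ?_) ?_ ?_
    (fun r hr => intervalIntegrable_abs_entry_mul_rpow u hr _ _) hσ
  · simpa only [angIntegral, hfun] using key
  · exact (((measurable_sign_pow _).comp (continuous_entryA u).measurable).mul
      ((measurable_sign_pow _).comp (continuous_entryB u).measurable)).mul
      (by fun_prop : Continuous fun α : ℝ => Complex.exp (Complex.I * m * α)).measurable
  · have h1 : ‖Complex.exp (Complex.I * m * α)‖ = 1 := by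
      rw [show Complex.I * m * α = ((m * α : ℝ) : ℂ) * Complex.I by push_cast; ring,
        Complex.norm_exp_ofReal_mul_I]
    rw [hw, norm_mul, norm_mul, h1, mul_one]
    exact mul_le_one₀ (norm_sign_pow_le _ _) (norm_nonneg _) (norm_sign_pow_le _ _)
  · exact ((continuous_entryA u).mul (continuous_entryB u)).abs.measurable
  · filter_upwards [ae_trig_ne_zero (x := Real.cosh u) (y := Real.sinh u) (Or.inl hch.ne'),
      ae_trig_ne_zero (x := -Real.sinh u) (y := -Real.cosh u) (Or.inr (neg_ne_zero.2 hch.ne'))]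
      with α hA hB
    rw [← entryA_eq] at hA
    rw [← entryB_eq] at hB
    exact abs_pos.2 (mul_ne_zero hA hB)

/-! ### The differential equation of the scaled integral -/

/-- The Poisson integral, scaled so as to solve the differential equation of `evenSol`. -/
noncomputable def scaledIntegral (δ δ' : ZMod 2) (m : ℤ) (σ : ℂ) (u : ℝ) : ℂ :=
  (Real.cosh (2 * u) : ℂ) ^ (σ + 1) * angIntegral δ δ' m σ u

theorem hasDerivAt_scaledIntegral (δ δ' : ZMod 2) (m : ℤ) {σ : ℂ} (hσ : 2 < σ.re) (u : ℝ) :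
    HasDerivAt (scaledIntegral δ δ' m σ)
      (2 * (2 * σ + 1) * ((Real.sinh (2 * u) : ℂ) / (Real.cosh (2 * u) : ℂ)) *
        scaledIntegral δ δ' m σ u - σ * scaledIntegral (δ + 1) (δ' + 1) m (σ - 1) u) u := by
  have hC := cosh_ofReal_ne_zero (2 * u)
  have hpos : 0 < Real.cosh (2 * u) := Real.cosh_pos _
  have h1 := ((hasDerivAt_id (Real.cosh (2 * u) : ℂ)).cpow_const (c := σ + 1)
    (Complex.ofReal_mem_slitPlane.2 hpos)).scomp u (hasDerivAt_cosh_two_mul u)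
  refine (h1.mul (hasDerivAt_angIntegral δ δ' m hσ u)).congr_deriv ?_
  simp only [scaledIntegral, Function.comp, id, smul_eq_mul, mul_one]
  rw [add_sub_cancel_right, sub_add_cancel, Complex.cpow_add _ _ hC, Complex.cpow_one]
  field_simp
  ring

/-- The first derivative involves level σ-1, whose own derivative involves level σ-2 with the
original parities. The recurrence eliminates level σ-2, and the equation closes. -/
theorem isTanhSol_scaledIntegral (δ δ' : ZMod 2) (m : ℤ) {σ : ℂ} (hσ : 3 < σ.re) :
    IsTanhSol (2 * (σ + 1) - 1) (4 * (σ + 1) ^ 2 - (m : ℂ) ^ 2) (scaledIntegral δ δ' m σ)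
      (fun u => 2 * (2 * σ + 1) * ((Real.sinh (2 * u) : ℂ) / (Real.cosh (2 * u) : ℂ)) *
        scaledIntegral δ δ' m σ u - σ * scaledIntegral (δ + 1) (δ' + 1) m (σ - 1) u) := by
  intro u
  have hC := cosh_ofReal_ne_zero (2 * u)
  have h1 := hasDerivAt_scaledIntegral δ δ' m (show 2 < σ.re by linarith) u
  have h2 := hasDerivAt_scaledIntegral (δ + 1) (δ' + 1) m (σ := σ - 1) (by simp; linarith) u
  have h11 : (1 : ZMod 2) + 1 = 0 := by decide
  rw [add_assoc, add_assoc, h11, add_zero, add_zero, show σ - 1 - 1 = σ - 2 by ring] at h2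
  refine ⟨h1, ?_⟩
  refine ((((hasDerivAt_tanh_two_mul u).const_mul (2 * (2 * σ + 1))).mul h1).sub
    (h2.const_mul σ)).congr_deriv ?_
  have hrec := angIntegral_recurrence δ δ' m hσ u
  have hrec' : (4 * σ ^ 2 - (m : ℂ) ^ 2) / (Real.cosh (2 * u) : ℂ) ^ 2 *
      scaledIntegral δ δ' m σ u + 2 * σ * (2 * σ - 1) *
      ((Real.sinh (2 * u) : ℂ) / (Real.cosh (2 * u) : ℂ)) *
        scaledIntegral (δ + 1) (δ' + 1) m (σ - 1) u -
      σ * (σ - 1) * scaledIntegral δ δ' m (σ - 2) u = 0 := by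
    simp only [scaledIntegral]
    have e1 : (Real.cosh (2 * u) : ℂ) ^ (σ + 1) =
        (Real.cosh (2 * u) : ℂ) ^ (σ - 2 + 1) * (Real.cosh (2 * u) : ℂ) ^ 2 := by
      rw [show σ + 1 = σ - 2 + 1 + (2 : ℕ) by push_cast; ring, Complex.cpow_add _ _ hC,
        Complex.cpow_natCast]
    have e2 : (Real.cosh (2 * u) : ℂ) ^ (σ - 1 + 1) =
        (Real.cosh (2 * u) : ℂ) ^ (σ - 2 + 1) * (Real.cosh (2 * u) : ℂ) := by
      rw [show σ - 1 + 1 = σ - 2 + 1 + 1 by ring, Complex.cpow_add _ _ hC, Complex.cpow_one]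
    rw [e1, e2]
    set C := (Real.cosh (2 * u) : ℂ)
    set S := (Real.sinh (2 * u) : ℂ)
    set E := C ^ (σ - 2 + 1)
    field_simp
    linear_combination E * hrec
  simp only []
  set C := (Real.cosh (2 * u) : ℂ)
  set S := (Real.sinh (2 * u) : ℂ)
  linear_combination -hrec'

theorem IsTanhSol.linear_comb {κ lam : ℂ} {y z y' z' : ℝ → ℂ} (h : IsTanhSol κ lam y z)
    (h' : IsTanhSol κ lam y' z') (a b : ℂ) :
    IsTanhSol κ lam (fun u => a * y u + b * y' u) (fun u => a * z u + b * z' u) := fun u =>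
  ⟨((h u).1.const_mul a).add ((h' u).1.const_mul b),
    (((h u).2.const_mul a).add ((h' u).2.const_mul b)).congr_deriv (by ring)⟩

/-- The formula for the Poisson integral at `b_u` when the kernel is smooth enough. -/
theorem angIntegral_eq (ε ξ : ZMod 2) {m : ℤ} (hm : (m : ZMod 2) = ε) {σ : ℂ} (hσ : 3 < σ.re)
    (u : ℝ) : angIntegral (ξ + ε) ξ m σ u = Complex.Gamma (σ + 1) *
      (Real.cosh (2 * u) : ℂ) ^ (-(σ + 1)) *
      (omega m ξ * cCoeff m (2 * σ + 1) *
          evenSol m (σ + 1) ((Real.sinh (2 * u) : ℂ) / (Real.cosh (2 * u) : ℂ)) -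
        1 / 2 * omega m (ξ + 1) * cCoeff m (2 * σ + 1 - 2) *
          oddSol m (σ + 1) ((Real.sinh (2 * u) : ℂ) / (Real.cosh (2 * u) : ℂ))) := by
  have hσ0 : σ ≠ 0 := fun h => by simp [h] at hσ; linarith
  have hC := cosh_ofReal_ne_zero (2 * u)
  have h0 := angIntegral_zero ε ξ hm (σ := σ) (by linarith)
  have h1 := angIntegral_zero ε (ξ + 1) hm (σ := σ - 1) (by simp; linarith)
  rw [sub_add_cancel, show 2 * (σ - 1) + 1 = 2 * σ + 1 - 2 by ring] at h1
  -- The coefficients are fixed by the data at u = 0. The derivative there is -σ times the base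
  -- value at level σ-1 and parity ξ+1, with σΓ(σ) = Γ(σ+1); the odd solution has u-derivative 2,
  -- whence the factor -1/2.
  have key := (isTanhSol_scaledIntegral (ξ + ε) ξ m hσ).eq
    ((isDiscSol_evenSol m (σ + 1)).isTanhSol.linear_comb (isDiscSol_oddSol m (σ + 1)).isTanhSol
      (Complex.Gamma (σ + 1) * (omega m ξ * cCoeff m (2 * σ + 1)))
      (Complex.Gamma (σ + 1) * (-(1 / 2) * omega m (ξ + 1) * cCoeff m (2 * σ + 1 - 2)))) ?_ ?_
  · have h2 := congrFun key u
    rw [scaledIntegral] at h2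
    rw [Complex.cpow_neg, ← div_eq_mul_inv, div_mul_eq_mul_div, eq_div_iff 
      (fun h => hC ((Complex.cpow_eq_zero_iff _ _).1 h).1), mul_comm,
      h2]
    ring
  · simp [scaledIntegral, h0, evenSol_zero, oddSol_zero]
    ring
  · have e : ξ + ε + 1 = ξ + 1 + ε := by ring
    simp [scaledIntegral, e, h1, Complex.Gamma_add_one σ hσ0]
    ring

/-! ### The entire continuation and the final formula -/

/-- The entire continuation of the normalized Poisson integral. -/
noncomputable def poissonFormula (ξ : ZMod 2) (m : ℤ) (θ u : ℝ) (ν : ℂ) : ℂ :=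
  Complex.exp (Complex.I * m * θ) * ((Real.cosh (2 * u) : ℂ) ^ (-((ν + 1) / 2)) *
    (omega m ξ * cCoeff m ν *
        evenSol m ((ν + 1) / 2) ((Real.sinh (2 * u) : ℂ) / (Real.cosh (2 * u) : ℂ)) -
      1 / 2 * omega m (ξ + 1) * cCoeff m (ν - 2) *
        oddSol m ((ν + 1) / 2) ((Real.sinh (2 * u) : ℂ) / (Real.cosh (2 * u) : ℂ))))

theorem differentiable_poissonFormula (ξ : ZMod 2) (m : ℤ) (θ u : ℝ) :
    Differentiable ℂ (poissonFormula ξ m θ u) := by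
  have hs : Differentiable ℂ fun ν : ℂ => (ν + 1) / 2 := by fun_prop
  have hT := norm_sinh_div_cosh_lt (2 * u)
  have h1 : Differentiable ℂ fun ν : ℂ => (Real.cosh (2 * u) : ℂ) ^ (-((ν + 1) / 2)) := fun ν =>
    hs.neg.differentiableAt.const_cpow (Or.inl (cosh_ofReal_ne_zero _))
  have h2 := differentiable_evenSol m hs hT
  have h3 := differentiable_oddSol m hs hT
  have h4 := differentiable_cCoeff m
  have h5 : Differentiable ℂ fun ν => cCoeff m (ν - 2) :=
    h4.comp (differentiable_id.sub_const 2)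
  exact (h1.mul (((h4.const_mul _).mul h2).sub ((h5.const_mul _).mul h3))).const_mul _

theorem poissonIntegrand_eq (ε ξ : ZMod 2) (ν μ : ℂ) (m : ℤ) (θ u φ : ℝ) :
    poissonIntegrand ε ξ 0 ν (zeta m μ) (kRot θ * bHyp u) φ =
      Complex.exp (Complex.I * m * θ) * (angKernel (ξ + ε) ξ ((ν - 1) / 2) u (φ - θ) *
        Complex.exp (Complex.I * m * (φ - θ : ℝ))) := by
  have h00 : ((kRot θ * bHyp u)⁻¹ * kRot φ) 0 0 = entryA u (φ - θ) := by
    rw [entryA, Real.cos_sub, Real.sin_sub]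
    change (Matrix.adjugate (!![Real.cos θ, Real.sin θ; -Real.sin θ, Real.cos θ] *
      !![Real.cosh u, Real.sinh u; Real.sinh u, Real.cosh u]) *
      !![Real.cos φ, Real.sin φ; -Real.sin φ, Real.cos φ]) 0 0 = _
    simp [Matrix.mul_apply, Fin.sum_univ_two, Matrix.adjugate_fin_two]
    ring
  have h10 : ((kRot θ * bHyp u)⁻¹ * kRot φ) 1 0 = entryB u (φ - θ) := by
    rw [entryB, Real.cos_sub, Real.sin_sub]
    change (Matrix.adjugate (!![Real.cos θ, Real.sin θ; -Real.sin θ, Real.cos θ] *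
      !![Real.cosh u, Real.sinh u; Real.sinh u, Real.cosh u]) *
      !![Real.cos φ, Real.sin φ; -Real.sin φ, Real.cos φ]) 1 0 = _
    simp [Matrix.mul_apply, Fin.sum_univ_two, Matrix.adjugate_fin_two]
    ring
  rw [poissonIntegrand, kernel, h00, h10, zeta_kRot, angKernel, zero_add, sub_zero,
    mul_left_comm, ← Complex.exp_add]
  congr 2
  push_cast; ring

theorem poissonIntegral_eq (ε ξ : ZMod 2) {ν : ℂ} (hν : -1 < ν.re) (μ : ℂ) (m : ℤ) (θ u : ℝ) :
    IntervalIntegrable (poissonIntegrand ε ξ 0 ν (zeta m μ) (kRot θ * bHyp u)) volume 0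
      (2 * Real.pi) ∧ poissonIntegral ε ξ 0 ν (zeta m μ) (kRot θ * bHyp u) =
        Complex.exp (Complex.I * m * θ) * angIntegral (ξ + ε) ξ m ((ν - 1) / 2) u := by
  have hσ : -1 < ((ν - 1) / 2).re := by simp; linarith
  set g : ℝ → ℂ := fun α => angKernel (ξ + ε) ξ ((ν - 1) / 2) u α *
    Complex.exp (Complex.I * m * α) with hg
  have hfun : poissonIntegrand ε ξ 0 ν (zeta m μ) (kRot θ * bHyp u) =
      fun φ => Complex.exp (Complex.I * m * θ) * g (φ - θ) :=
    funext fun φ => poissonIntegrand_eq ε ξ ν μ m θ u φ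
  have hper : Function.Periodic g (2 * Real.pi) := fun α => by
    simp only [hg, angKernel]
    rw [entryA_add_two_pi, entryB_add_two_pi, exp_add_two_pi]
  have hi := (differentiableAt_angIntegral (ξ + ε) ξ m u hσ).1
  constructor
  · rw [hfun]
    have := (hper.intervalIntegrable₀ (by positivity) hi (-θ) (2 * Real.pi - θ)).comp_sub_right θ
    rw [neg_add_cancel, sub_add_cancel] at this
    exact this.const_mul _
  · rw [poissonIntegral, hfun, intervalIntegral.integral_const_mul,
      intervalIntegral.integral_comp_sub_right, zero_sub, sub_eq_neg_add,
      hper.intervalIntegral_add_eq (-θ) 0, zero_add, angIntegral]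

/-- Both sides are holomorphic on the half-plane Re ν > -1, which is convex, so agreement near one
point far to the right is enough. -/
theorem isPoissonContinuation_poissonFormula (ε ξ : ZMod 2) {m : ℤ} (hm : (m : ZMod 2) = ε)
    (μ : ℂ) (θ u : ℝ) : IsPoissonContinuation ε ξ 0 (zeta m μ) (kRot θ * bHyp u)
      (poissonFormula ξ m θ u) := by
  refine ⟨differentiable_poissonFormula ξ m θ u, fun ν hν =>
    ⟨(poissonIntegral_eq ε ξ hν μ m θ u).1, ?_⟩⟩
  have ho : IsOpen {ν : ℂ | -1 < ν.re} := isOpen_lt continuous_const Complex.continuous_re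
  have hpre : IsPreconnected {ν : ℂ | -1 < ν.re} := (convex_halfSpace_re_gt (-1)).isPreconnected
  set H : ℂ → ℂ := fun ν => Complex.exp (Complex.I * m * θ) *
    (angIntegral (ξ + ε) ξ m ((ν - 1) / 2) u * (Complex.Gamma ((ν + 1) / 2))⁻¹) with hH
  have hHd : DifferentiableOn ℂ H {ν : ℂ | -1 < ν.re} := fun ν hν => by
    have hσ : -1 < ((ν - 1) / 2).re := by
      have : -1 < ν.re := hν
      simp; linarith
    have h1 : DifferentiableAt ℂ (fun ν : ℂ => angIntegral (ξ + ε) ξ m ((ν - 1) / 2) u) ν :=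
      (differentiableAt_angIntegral (ξ + ε) ξ m u hσ).2.comp ν
        (f := fun ν : ℂ => (ν - 1) / 2) (by fun_prop)
    have h2 : DifferentiableAt ℂ (fun ν : ℂ => (Complex.Gamma ((ν + 1) / 2))⁻¹) ν :=
      (Complex.differentiable_one_div_Gamma _).comp ν (f := fun ν : ℂ => (ν + 1) / 2) (by fun_prop)
    exact ((h1.mul h2).const_mul _).differentiableWithinAt
  -- Re ν > 7 means Re σ > 3 for σ = (ν-1)/2, the range of `angIntegral_eq`; 8 is a point of this
  -- range.
  have hev : poissonFormula ξ m θ u =ᶠ[𝓝 (8 : ℂ)] H := by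
    have ho' : IsOpen {ν : ℂ | 7 < ν.re} := isOpen_lt continuous_const Complex.continuous_re
    filter_upwards [ho'.mem_nhds (show (7 : ℝ) < (8 : ℂ).re by norm_num)] with w hw
    have hw' : 7 < w.re := hw
    have hG : Complex.Gamma ((w + 1) / 2) ≠ 0 :=
      Complex.Gamma_ne_zero_of_re_pos (by simp; linarith)
    simp only [hH]
    rw [angIntegral_eq ε ξ hm (by simp; linarith), poissonFormula,
      show (w - 1) / 2 + 1 = (w + 1) / 2 by ring, show 2 * ((w - 1) / 2) + 1 = w by ring]
    field_simp
  have hmain := ((differentiable_poissonFormula ξ m θ u).differentiableOn.analyticOnNhd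
    ho).eqOn_of_preconnected_of_eventuallyEq (hHd.analyticOnNhd ho) hpre
    (show (8 : ℂ) ∈ {ν : ℂ | -1 < ν.re} by norm_num) hev hν
  rw [hmain, (poissonIntegral_eq ε ξ hν μ m θ u).2, hH, div_eq_mul_inv]
  ring

end PoissonSL2

theorem mainTheorem6 (ε ξ : ZMod 2) (m : ℤ) (hm : (m : ZMod 2) = ε) (μ : ℂ) (θ u : ℝ) :
    (∃ F : ℂ → ℂ, PoissonSL2.IsPoissonContinuation ε ξ 0 (PoissonSL2.zeta m μ)
      (PoissonSL2.kRot θ * PoissonSL2.bHyp u) F) ∧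
    PoissonSL2.normalizedPoisson ε ξ 0 μ (PoissonSL2.zeta m μ)
        (PoissonSL2.kRot θ * PoissonSL2.bHyp u) =
      PoissonSL2.zeta m μ (PoissonSL2.kRot θ) *
        ((Real.cosh (2 * u) ^ ((m : ℝ) / 2) : ℝ) : ℂ) *
        (PoissonSL2.omega m ξ * PoissonSL2.cCoeff m μ * PoissonSL2.phi m μ (2 * u) +
          Complex.I / 2 * PoissonSL2.omega m (ξ + 1) * PoissonSL2.cCoeff m (μ - 2) *
            PoissonSL2.psi m μ (2 * u)) := by
  have hF := PoissonSL2.isPoissonContinuation_poissonFormula ε ξ hm μ θ u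
  refine ⟨⟨_, hF⟩, ?_⟩
  rw [PoissonSL2.normalizedPoisson_eq hF, PoissonSL2.zeta_kRot, PoissonSL2.poissonFormula]
  have h1 := PoissonSL2.cosh_rpow_mul_phi m μ (2 * u)
  have h2 := PoissonSL2.cosh_rpow_mul_psi m μ (2 * u)
  -- The factor i in ψ meets the coefficient i/2, giving the -1/2 in `poissonFormula`.
  linear_combination
    (-Complex.exp (Complex.I * m * θ) * PoissonSL2.omega m ξ * PoissonSL2.cCoeff m μ) * h1 -
    (Complex.exp (Complex.I * m * θ) * (Complex.I / 2 * PoissonSL2.omega m (ξ + 1) *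
      PoissonSL2.cCoeff m (μ - 2))) * h2 -
    (Complex.exp (Complex.I * m * θ) * (1 / 2 * PoissonSL2.omega m (ξ + 1) *
      PoissonSL2.cCoeff m (μ - 2)) * ((Real.cosh (2 * u) : ℂ) ^ (-((μ + 1) / 2)) *
      PoissonSL2.oddSol m ((μ + 1) / 2) ((Real.sinh (2 * u) : ℂ) / (Real.cosh (2 * u) : ℂ)))) *
      Complex.I_sq
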